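/- Let $d\ge 1$. Regard $\mathbb Z^d$ as the Cayley graph of the group $\mathbb Z^d$ with the standard generators. For $n\ge 0$ let $B_n=\{0,1,\dots,n\}^d$, and let $\partial_n$ be the set of vertices of $B_n$ with at least one coordinate equal to $0$ or $n$; both are regarded as induced subgraphs of $\mathbb Z^d$. The target graphs $H$ are nonempty, connected and simple, and $H$ and $\mathbb Z^d$ carry their path metrics; $\partial_n$ carries the metric restricted from $\mathbb Z^d$. A bipartite graph $H$ is called \emph{bipartite $(2d,2)$-Helly} if for each partite class $H_1$ of $H$ and all closed balls $C_1,\dots,C_{2d}$ of radius at least $1$ in $H$ (repetitions allowed) such that $C_i\cap C_j\cap H_1\neq\varnothing$ for all $i\ne j$, we have $C_1\cap\dots\cap C_{2d}\cap H_1\neq\varnothing$. \textbf{Theorem.} Fix $d\ge 1$. (1) There are an algorithm and a polynomial $p$, depending only on $d$, such that for every finite bipartite $(2d,2)$-Helly graph $H$, every $n\ge0$ and every graph homomorphism $f\colon\partial_n\to H$, the algorithm, given $n$, the adjacency matrix of $H$ and a table of the values of $f$, decides in at most $p(n+|H|)$ steps whether $f$ extends to a graph homomorphism $B_n\to H$.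 (An algorithm is a program of a random access machine with unit-cost addition, truncated subtraction, indirect memory access and tests for zero.) (2) Let $H$ be a finite bipartite $(2d,2)$-Helly graph, $n\ge0$, and $f\colon\partial_n\to H$ a graph homomorphism. If $d\ge2$, then $f$ extends to a graph homomorphism $B_n\to H$ if and only if $f$ is $1$-Lipschitz, that is, $d_H(f(x),f(y))\le d_{\mathbb Z^d}(x,y)$ for all $x,y\in\partial_n$. If $d=1$ and $|H|\ge 2$, then $f$ extends if and only if $f$ is $1$-Lipschitz and $d_H(f(x),f(y))\equiv d_{\mathbb Z}(x,y)\pmod 2$ for all $x,y\in\partial_n$. -/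

import Mathlib

/-- The lattice `ℤ^d`: the Cayley graph of the group `ℤ^d` with respect to the standard
generators. -/
def latticeGraph (d : ℕ) : SimpleGraph (Fin d → ℤ) :=
  SimpleGraph.addCayley (Set.range fun i : Fin d => (Pi.single i 1 : Fin d → ℤ))

/-- The vertices of the box `B_n = {0, 1, …, n}^d`. -/
def box (d n : ℕ) : Set (Fin d → ℤ) :=
  {x | ∀ i, 0 ≤ x i ∧ x i ≤ n}

/-- The vertices of the boundary `∂_n`: the vertices of the box with at least one coordinate
equal to `0` or `n`. -/
def boxBoundary (d n : ℕ) : Set (Fin d → ℤ) :=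
  {x | x ∈ box d n ∧ ∃ i, x i = 0 ∨ x i = n}

/-- The box as a subgraph of `ℤ^d`. -/
abbrev boxGraph (d n : ℕ) : SimpleGraph (box d n) :=
  (latticeGraph d).induce (box d n)

/-- The boundary of the box as a subgraph of `ℤ^d`. -/
abbrev boundaryGraph (d n : ℕ) : SimpleGraph (boxBoundary d n) :=
  (latticeGraph d).induce (boxBoundary d n)

/-- `f ∈ Hom(∂_n, H)` extends to a graph homomorphism `g ∈ Hom(B_n, H)`. -/
def ExtendsToBox {V : Type*} {H : SimpleGraph V} {d n : ℕ} (f : boundaryGraph d n →g H) : Prop :=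
  ∃ g : boxGraph d n →g H, ∀ x : boxBoundary d n, g ⟨x.1, x.2.1⟩ = f x

/-- `f : ∂_n → H` is `1`-Lipschitz, where `∂_n ⊂ ℤ^d` has the metric restricted from the path
metric of `ℤ^d`, and `H` has its path metric. -/
def IsOneLipschitz {V : Type*} {H : SimpleGraph V} {d n : ℕ} (f : boundaryGraph d n →g H) : Prop :=
  ∀ x y : boxBoundary d n, H.dist (f x) (f y) ≤ (latticeGraph d).dist x.1 y.1

/-- `H` is bipartite `(n, m)`-Helly: `H` is bipartite, and whenever `n` closed balls of radius
at least `1` (in the path metric) are such that any `m` of them have a common point in a given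
partite class, all `n` of them have a common point in this partite class.  The partite classes
are the colour classes of the proper `2`-colourings of `H`. -/
def IsBipartiteHelly {V : Type*} (H : SimpleGraph V) (n m : ℕ) : Prop :=
  H.IsBipartite ∧
    ∀ (c : H.Coloring (Fin 2)) (k : Fin 2) (v : Fin n → V) (r : Fin n → ℕ),
      (∀ i, 1 ≤ r i) →
      (∀ I : Finset (Fin n), I.card = m → ∃ x ∈ c.colorClass k, ∀ i ∈ I, H.dist (v i) x ≤ r i) →
      ∃ x ∈ c.colorClass k, ∀ i, H.dist (v i) x ≤ r i

namespace RAM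

/-- Programs of a random access machine.  The machine has registers `R_0, R_1, …`, of which a
program can name only finitely many, and a main memory `M[0], M[1], …`; all of them hold natural
numbers.  Main memory is accessed by indirect addressing only. -/
inductive Program : Type
  /-- `R_i := c` -/
  | const (i c : ℕ) : Program
  /-- `R_i := R_j + R_k` -/
  | add (i j k : ℕ) : Program
  /-- `R_i := max (R_j - R_k) 0` -/
  | sub (i j k : ℕ) : Program
  /-- `R_i := M[R_j]` -/
  | load (i j : ℕ) : Program
  /-- `M[R_i] := R_j` -/
  | store (i j : ℕ) : Program
  /-- first `P`, then `Q` -/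
  | seq (P Q : Program) : Program
  /-- if `R_i ≠ 0` then `P` else `Q` -/
  | ite (i : ℕ) (P Q : Program) : Program
  /-- while `R_i ≠ 0` do `P` -/
  | loop (i : ℕ) (P : Program) : Program

/-- The contents of the registers and of the main memory. -/
structure State : Type where
  reg : ℕ → ℕ
  mem : ℕ → ℕ

/-- `Exec P s t s'`: the program `P`, started in the state `s`, halts after exactly `t` steps in
the state `s'`.  Each assignment and each test of a register takes one step.  A sum or difference
at most doubles the largest number present, so that numbers of at most `t` more bits than those in
the input are written in `t` steps, and polynomial time here is the usual polynomial time of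
Turing machines. -/
inductive Exec : Program → State → ℕ → State → Prop
  | const (i c : ℕ) (s : State) :
      Exec (.const i c) s 1 ⟨Function.update s.reg i c, s.mem⟩
  | add (i j k : ℕ) (s : State) :
      Exec (.add i j k) s 1 ⟨Function.update s.reg i (s.reg j + s.reg k), s.mem⟩
  | sub (i j k : ℕ) (s : State) :
      Exec (.sub i j k) s 1 ⟨Function.update s.reg i (s.reg j - s.reg k), s.mem⟩
  | load (i j : ℕ) (s : State) :
      Exec (.load i j) s 1 ⟨Function.update s.reg i (s.mem (s.reg j)), s.mem⟩
  | store (i j : ℕ) (s : State) :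
      Exec (.store i j) s 1 ⟨s.reg, Function.update s.mem (s.reg i) (s.reg j)⟩
  | seq {P Q : Program} {s s' s'' : State} {t t' : ℕ} :
      Exec P s t s' → Exec Q s' t' s'' → Exec (.seq P Q) s (t + t') s''
  | ite_pos {i : ℕ} {P Q : Program} {s s' : State} {t : ℕ} :
      s.reg i ≠ 0 → Exec P s t s' → Exec (.ite i P Q) s (t + 1) s'
  | ite_zero {i : ℕ} {P Q : Program} {s s' : State} {t : ℕ} :
      s.reg i = 0 → Exec Q s t s' → Exec (.ite i P Q) s (t + 1) s'
  | loop_pos {i : ℕ} {P : Program} {s s' s'' : State} {t t' : ℕ} :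
      s.reg i ≠ 0 → Exec P s t s' → Exec (.loop i P) s' t' s'' →
      Exec (.loop i P) s (t + t' + 1) s''
  | loop_zero {i : ℕ} {P : Program} {s : State} :
      s.reg i = 0 → Exec (.loop i P) s 1 s

/-- The machine is deterministic: a program started in a given state has at most one outcome and
at most one number of steps. -/
theorem Exec.deterministic {P : Program} {s s₁ s₂ : State} {t₁ t₂ : ℕ}
    (h₁ : Exec P s t₁ s₁) (h₂ : Exec P s t₂ s₂) : t₁ = t₂ ∧ s₁ = s₂ := by
  induction h₁ generalizing t₂ s₂ with
  | const => cases h₂; exact ⟨rfl, rfl⟩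
  | add => cases h₂; exact ⟨rfl, rfl⟩
  | sub => cases h₂; exact ⟨rfl, rfl⟩
  | load => cases h₂; exact ⟨rfl, rfl⟩
  | store => cases h₂; exact ⟨rfl, rfl⟩
  | seq _ _ ih ih' =>
    cases h₂ with
    | seq h h' =>
      obtain ⟨rfl, rfl⟩ := ih h
      obtain ⟨rfl, rfl⟩ := ih' h'
      exact ⟨rfl, rfl⟩
  | ite_pos hi _ ih =>
    cases h₂ with
    | ite_pos _ h => obtain ⟨rfl, rfl⟩ := ih h; exact ⟨rfl, rfl⟩
    | ite_zero hz _ => exact absurd hz hi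
  | ite_zero hi _ ih =>
    cases h₂ with
    | ite_pos hp _ => exact absurd hi hp
    | ite_zero _ h => obtain ⟨rfl, rfl⟩ := ih h; exact ⟨rfl, rfl⟩
  | loop_pos hi _ _ ih ih' =>
    cases h₂ with
    | loop_pos _ h h' =>
      obtain ⟨rfl, rfl⟩ := ih h
      obtain ⟨rfl, rfl⟩ := ih' h'
      exact ⟨rfl, rfl⟩
    | loop_zero hz => exact absurd hz hi
  | loop_zero hi =>
    cases h₂ with
    | loop_pos hp _ _ => exact absurd hi hp
    | loop_zero _ => exact ⟨rfl, rfl⟩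

/-- The initial state on a given input: the input word stands at the beginning of the main memory,
and everything else is `0`. -/
def initialState (w : List ℕ) : State where
  reg := fun _ => 0
  mem := fun a => w.getD a 0

end RAM

open Classical in
/-- The adjacency matrix of a graph with vertices `0, …, N - 1`, row by row. -/
noncomputable def adjacencyWord {N : ℕ} (H : SimpleGraph (Fin N)) : List ℕ :=
  List.ofFn fun k : Fin (N * N) => if H.Adj k.divNat k.modNat then 1 else 0

/-- The vertex of the box `{0, …, n}^d` whose coordinates are the digits of `k` in base `n + 1`,
least significant digit first. -/
def boxPoint {d n : ℕ} (k : Fin ((n + 1) ^ d)) : Fin d → ℤ :=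
  fun i => ((finFunctionFinEquiv.symm k i : ℕ) : ℤ)

open Classical in
/-- The table of `f : ∂_n → H`: it has an entry for each vertex of the box, which is `f x + 1` if
`x` lies on the boundary and `0` if `x` lies in the hole. -/
noncomputable def boundaryWord {N d n : ℕ} {H : SimpleGraph (Fin N)} (f : boundaryGraph d n →g H) :
    List ℕ :=
  List.ofFn fun k : Fin ((n + 1) ^ d) =>
    if h : boxPoint k ∈ boxBoundary d n then (f ⟨boxPoint k, h⟩ : ℕ) + 1 else 0

/-- An instance of the hole-filling problem as an input word: the numbers `n` and `|H|`, the
adjacency matrix of `H`, and the table of `f`. -/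
noncomputable def instanceWord {N d n : ℕ} {H : SimpleGraph (Fin N)} (f : boundaryGraph d n →g H) :
    List ℕ :=
  n :: N :: (adjacencyWord H ++ boundaryWord f)

/-- The program `P` answers the question whether `p` holds on the input word `w` within `T` steps:
it halts, with `1` (yes) or `0` (no) in register `R_0`. -/
def RAM.AnswersWithin (P : RAM.Program) (w : List ℕ) (p : Prop) (T : ℕ) : Prop :=
  ∃ (t : ℕ) (s : RAM.State), t ≤ T ∧ RAM.Exec P (RAM.initialState w) t s ∧
    (p → s.reg 0 = 1) ∧ (¬ p → s.reg 0 = 0)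

/-! Both statements rest on one condition, `BoundaryWalks`: any two values `f x`, `f y` are joined
in `H` by a walk whose length is exactly the ℓ¹ distance of `x` and `y`. It is necessary, because
the box contains a path of that length from `x` to `y`, and an extension maps it to a walk.

For sufficiency, the map is extended one point `b` at a time, keeping the condition for all pairs
(`exists_extension_point`). If at most `2d` points are prescribed, the balls around their values,
with radii the distances to `b`, meet pairwise in the right partite class: a walk between two values
can be lengthened to the sum of the two radii and cut. The Helly property then gives a common point.
If there are more than `2d` points, some point `a` is not the sole extremum in any coordinate. Move
`b` one step towards `a`, to `b'`; the same step approaches another prescribed point `q`. By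
induction on the distance to `a` there is a value `w` at `b'`. Replacing `a` and `q` by `b'` lowers
the number of points, so by induction there is a value at `b` adjacent to `w`, and walks from the
values at `a` and `q` reach it through `w`.

In a connected bipartite graph with an edge, a walk of length `r` exists iff `r` is at least the
distance and has its parity. So the condition is the Lipschitz bound plus a parity condition, and
the latter is automatic for `d ≥ 2`, where the boundary is connected.

The algorithm tabulates, by dynamic programming, which vertices are joined by walks of each length
up to `d * n`, and looks up all pairs of boundary points. -/

/-- There is a walk of length exactly `r` from `u` to `v`. -/
def SimpleGraph.HasWalk {V : Type*} (H : SimpleGraph V) (u v : V) (r : ℕ) : Prop :=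
  ∃ p : H.Walk u v, p.length = r

/-! ### Walks of prescribed length in connected bipartite graphs. -/

namespace SimpleGraph

variable {V : Type*} {H : SimpleGraph V} {u v w : V} {r s : ℕ}

theorem HasWalk.refl (H : SimpleGraph V) (u : V) : H.HasWalk u u 0 := ⟨.nil, rfl⟩

theorem HasWalk.symm (h : H.HasWalk u v r) : H.HasWalk v u r := by
  obtain ⟨p, rfl⟩ := h
  exact ⟨p.reverse, p.length_reverse⟩

theorem HasWalk.trans (h : H.HasWalk u v r) (h' : H.HasWalk v w s) : H.HasWalk u w (r + s) := by
  obtain ⟨p, rfl⟩ := h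
  obtain ⟨q, rfl⟩ := h'
  exact ⟨p.append q, p.length_append q⟩

theorem Adj.hasWalk (h : H.Adj u v) : H.HasWalk u v 1 := ⟨h.toWalk, rfl⟩

theorem HasWalk.split (h : H.HasWalk u v (r + s)) : ∃ x, H.HasWalk u x r ∧ H.HasWalk x v s := by
  obtain ⟨p, hp⟩ := h
  exact ⟨p.getVert r, ⟨p.take r, by simp [hp]⟩, ⟨p.drop r, by simp [hp]⟩⟩

theorem hasWalk_zero : H.HasWalk u v 0 ↔ u = v := by
  constructor
  · rintro ⟨p, hp⟩
    exact Walk.eq_of_length_eq_zero hp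
  · rintro rfl
    exact .refl H u

theorem hasWalk_one : H.HasWalk u v 1 ↔ H.Adj u v := by
  constructor
  · rintro ⟨p, hp⟩
    exact Walk.adj_of_length_eq_one hp
  · exact Adj.hasWalk

theorem hasWalk_succ : H.HasWalk u v (r + 1) ↔ ∃ w, H.HasWalk u w r ∧ H.Adj w v := by
  constructor
  · intro h
    obtain ⟨x, hx, hx'⟩ := h.split
    exact ⟨x, hx, hasWalk_one.1 hx'⟩
  · rintro ⟨w, hw, hwv⟩
    exact hw.trans hwv.hasWalk

theorem HasWalk.eq_zero [Subsingleton V] (h : H.HasWalk u v r) : r = 0 := by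
  cases r with
  | zero => rfl
  | succ r =>
    obtain ⟨w, -, hw⟩ := hasWalk_succ.1 h
    exact absurd (Subsingleton.elim _ _) hw.ne

theorem HasWalk.map {W : Type*} {G : SimpleGraph W} (h : H.HasWalk u v r) (f : H →g G) :
    G.HasWalk (f u) (f v) r := by
  obtain ⟨p, rfl⟩ := h
  exact ⟨p.map f, p.length_map f⟩

theorem HasWalk.dist_le (h : H.HasWalk u v r) : H.dist u v ≤ r := by
  obtain ⟨p, rfl⟩ := h
  exact SimpleGraph.dist_le p

theorem Connected.hasWalk_dist (hH : H.Connected) (u v : V) : H.HasWalk u v (H.dist u v) :=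
  hH.exists_walk_length_eq_dist u v

/-- In a connected graph with an edge, walks can be prolonged by going to and fro. -/
theorem HasWalk.add_even [Nontrivial V] (hH : H.Connected) (h : H.HasWalk u v r) (k : ℕ) :
    H.HasWalk u v (r + 2 * k) := by
  induction k with
  | zero => exact h
  | succ k ih =>
    obtain ⟨w, hw⟩ := hH.preconnected.exists_adj_of_nontrivial v
    exact (ih.trans hw.hasWalk).trans hw.symm.hasWalk

theorem HasWalk.of_le [Nontrivial V] (hH : H.Connected) (h : H.HasWalk u v r) (hrs : r ≤ s)
    (he : Even (r + s)) : H.HasWalk u v s := by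
  obtain ⟨k, hk⟩ := he
  convert h.add_even hH (k - r) using 1
  omega

/-- With two colours, each step of a walk switches the colour. -/
theorem HasWalk.even_iff (c : H.Coloring (Fin 2)) (h : H.HasWalk u v r) :
    Even r ↔ c u = c v := by
  obtain ⟨p, rfl⟩ := h
  induction p with
  | nil => simp
  | @cons u v w huv p ih =>
    have := c.valid huv
    rw [Walk.length_cons, Nat.even_add_one, ih]
    generalize c u = a at *
    generalize c v = b at *
    generalize c w = e at *
    omega

/-- In a connected bipartite graph with an edge there is a walk of length `r` iff `r` is at least
the distance and has the same parity. -/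
theorem hasWalk_iff [Nontrivial V] (hH : H.Connected) (hb : H.IsBipartite) :
    H.HasWalk u v r ↔ H.dist u v ≤ r ∧ Even (H.dist u v + r) := by
  obtain ⟨c⟩ := hb
  constructor
  · intro h
    exact ⟨h.dist_le, by rw [Nat.even_add, (hH.hasWalk_dist u v).even_iff c, h.even_iff c]⟩
  · rintro ⟨h, he⟩
    exact (hH.hasWalk_dist u v).of_le hH h he

end SimpleGraph

/-! ### The ℓ¹ metric on the lattice and on the box. -/

/-- The `ℓ¹` distance on `ℤ^d`. -/
def l1Dist {d : ℕ} (x y : Fin d → ℤ) : ℕ := ∑ i, (x i - y i).natAbs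

section Lattice

variable {d : ℕ} {x y z : Fin d → ℤ}

theorem l1Dist_comm (x y : Fin d → ℤ) : l1Dist x y = l1Dist y x := by
  unfold l1Dist
  congr 1 with i
  omega

theorem l1Dist_self (x : Fin d → ℤ) : l1Dist x x = 0 := by simp [l1Dist]

theorem l1Dist_eq_zero : l1Dist x y = 0 ↔ x = y := by
  simp [l1Dist, funext_iff, sub_eq_zero]

theorem l1Dist_triangle (x y z : Fin d → ℤ) : l1Dist x z ≤ l1Dist x y + l1Dist y z := by
  unfold l1Dist
  rw [← Finset.sum_add_distrib]
  exact Finset.sum_le_sum fun i _ => by omega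

theorem even_l1Dist_iff (x y : Fin d → ℤ) : Even (l1Dist x y) ↔ Even (∑ i, x i - ∑ i, y i) := by
  rw [← Finset.sum_sub_distrib, ← Int.even_coe_nat, l1Dist, Nat.cast_sum]
  have : Even (∑ i, ((x i - y i).natAbs : ℤ) - ∑ i, (x i - y i)) := by
    rw [← Finset.sum_sub_distrib]
    refine Finset.even_sum _ fun i _ => ?_
    rw [Int.even_sub, Int.even_coe_nat, Int.natAbs_even]
  exact Int.even_sub.1 this

theorem even_l1Dist_add (x y z : Fin d → ℤ) :
    Even (l1Dist x z + (l1Dist x y + l1Dist y z)) := by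
  simp only [Nat.even_add, even_l1Dist_iff, Int.even_sub]
  tauto

theorem l1Dist_update (x y : Fin d → ℤ) (i : Fin d) (c : ℤ) :
    l1Dist (Function.update x i c) y + (x i - y i).natAbs = l1Dist x y + (c - y i).natAbs := by
  unfold l1Dist
  rw [← Finset.add_sum_erase _ _ (Finset.mem_univ i),
    ← Finset.add_sum_erase (a := i) _ (fun i => (x i - y i).natAbs) (Finset.mem_univ i),
    Finset.sum_congr rfl (g := fun i => (x i - y i).natAbs)]
  · simp only [Function.update_self]
    omega
  · intro j hj
    rw [Function.update_of_ne (Finset.ne_of_mem_erase hj)]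

theorem latticeGraph_adj_update (x : Fin d → ℤ) (i : Fin d) {c : ℤ} (hc : c = x i + 1 ∨ x i = c + 1) :
    (latticeGraph d).Adj x (Function.update x i c) := by
  rw [latticeGraph, SimpleGraph.addCayley_adj']
  refine ⟨fun h => ?_, _, ⟨i, rfl⟩, hc.imp (fun h => ?_) fun h => ?_⟩
  · have := congrFun h i
    simp at this
    omega
  all_goals
    ext j
    obtain rfl | hj := eq_or_ne j i
    · simp [h]
    · simp [hj]

theorem l1Dist_of_adj (h : (latticeGraph d).Adj x y) : l1Dist x y = 1 := by
  rw [latticeGraph, SimpleGraph.addCayley_adj'] at h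
  have key : ∀ (z : Fin d → ℤ) (i : Fin d), l1Dist z (z + Pi.single i 1) = 1 := fun z i => by
    simp [l1Dist, Pi.single_apply, apply_ite]
  obtain ⟨-, _, ⟨i, rfl⟩, rfl | rfl⟩ := h
  · exact key _ _
  · rw [l1Dist_comm]
    exact key _ _

theorem l1Dist_le_of_hasWalk {r : ℕ} (h : (latticeGraph d).HasWalk x y r) : l1Dist x y ≤ r := by
  obtain ⟨p, rfl⟩ := h
  induction p with
  | nil => simp [l1Dist_self]
  | @cons u v w huv p ih =>
    have := l1Dist_triangle u v w
    rw [l1Dist_of_adj huv] at this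
    rw [SimpleGraph.Walk.length_cons]
    omega

/-- A unit step from `a` in the direction of `b`. -/
theorem exists_unit_step {a b : ℤ} (h : a ≠ b) :
    ∃ c, (c = a + 1 ∨ a = c + 1) ∧ (a ≤ c ∧ c ≤ b ∨ b ≤ c ∧ c ≤ a) ∧
      (c - b).natAbs + 1 = (a - b).natAbs := by
  rcases lt_or_gt_of_ne h with h | h
  · exact ⟨a + 1, by omega⟩
  · exact ⟨a - 1, by omega⟩

/-- Moving one coordinate at a time towards its target never leaves the box. -/
theorem boxGraph_hasWalk {n : ℕ} (x y : box d n) : (boxGraph d n).HasWalk x y (l1Dist x.1 y.1) := by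
  induction h : l1Dist x.1 y.1 generalizing x with
  | zero =>
    rw [SimpleGraph.hasWalk_zero]
    exact Subtype.ext (l1Dist_eq_zero.1 h)
  | succ r ih =>
    obtain ⟨i, hi⟩ : ∃ i, x.1 i ≠ y.1 i := by
      by_contra! hxy
      rw [l1Dist_eq_zero.2 (funext hxy)] at h
      omega
    obtain ⟨c, hc, hcb, hcd⟩ := exists_unit_step hi
    have hu := l1Dist_update x.1 y.1 i c
    have hx' : Function.update x.1 i c ∈ box d n := by
      intro j
      obtain rfl | hj := eq_or_ne j i
      · have := x.2 j
        have := y.2 j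
        rw [Function.update_self]
        omega
      · rw [Function.update_of_ne hj]
        exact x.2 j
    have hadj : (boxGraph d n).Adj x ⟨_, hx'⟩ := latticeGraph_adj_update x.1 i hc
    rw [add_comm]
    exact hadj.hasWalk.trans (ih ⟨_, hx'⟩ (by dsimp only; omega))

theorem latticeGraph_dist_eq {n : ℕ} (hx : x ∈ box d n) (hy : y ∈ box d n) :
    (latticeGraph d).dist x y = l1Dist x y := by
  have h : (latticeGraph d).HasWalk x y (l1Dist x y) :=
    (boxGraph_hasWalk ⟨x, hx⟩ ⟨y, hy⟩).map (SimpleGraph.Embedding.induce (box d n)).toHom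
  refine le_antisymm h.dist_le (l1Dist_le_of_hasWalk ?_)
  obtain ⟨p, -⟩ := h
  exact p.reachable.exists_walk_length_eq_dist

end Lattice

/-! ### Extending walk-compatible maps point by point. -/

section Extension

variable {V : Type*} {H : SimpleGraph V} {d : ℕ}

/-- Any two of the values that `F` takes on `A` are joined by a walk in `H` whose length is the
distance of the arguments. -/
def WalkCompatible (H : SimpleGraph V) (A : Finset (Fin d → ℤ)) (F : (Fin d → ℤ) → V) : Prop :=
  ∀ a ∈ A, ∀ b ∈ A, H.HasWalk (F a) (F b) (l1Dist a b)

theorem WalkCompatible.mono {A B : Finset (Fin d → ℤ)} {F : (Fin d → ℤ) → V}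
    (h : WalkCompatible H B F) (hAB : A ⊆ B) : WalkCompatible H A F :=
  fun a ha b hb => h a (hAB ha) b (hAB hb)

open Classical in
theorem WalkCompatible.insert {A : Finset (Fin d → ℤ)} {F : (Fin d → ℤ) → V}
    (h : WalkCompatible H A F) {b : Fin d → ℤ} {v : V}
    (hv : ∀ a ∈ A, H.HasWalk (F a) v (l1Dist a b)) (hb : b ∉ A) :
    WalkCompatible H (insert b A) (Function.update F b v) := by
  have key : ∀ a ∈ A, Function.update F b v a = F a := fun a ha =>
    Function.update_of_ne (by rintro rfl; exact hb ha) _ _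
  intro x hx y hy
  rw [Finset.mem_insert] at hx hy
  rcases hx with rfl | hx <;> rcases hy with rfl | hy
  · rw [l1Dist_self, SimpleGraph.hasWalk_zero]
  · rw [key y hy, Function.update_self, l1Dist_comm]
    exact (hv y hy).symm
  · rw [key x hx, Function.update_self]
    exact hv x hx
  · rw [key x hx, key y hy]
    exact h x hx y hy

/-- The one-point extension for at most `2d` points: this is the Helly property. -/
theorem IsBipartiteHelly.exists_of_card_le [Nontrivial V] (hH : H.Connected)
    (hHelly : IsBipartiteHelly H (2 * d) 2) {A : Finset (Fin d → ℤ)} {F : (Fin d → ℤ) → V}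
    (hA : WalkCompatible H A F) (hcard : A.card ≤ 2 * d) (b : Fin d → ℤ) :
    ∃ v, ∀ a ∈ A, H.HasWalk (F a) v (l1Dist a b) := by
  obtain rfl | ⟨a₀, ha₀⟩ := A.eq_empty_or_nonempty
  · exact ⟨hH.nonempty.some, by simp⟩
  by_cases hb : b ∈ A
  · exact ⟨F b, fun a ha => hA a ha b hb⟩
  obtain ⟨⟨c⟩, hHelly⟩ := hHelly
  -- The Helly property is about exactly `2 * d` balls, so points of `A` are repeated if there are
  -- fewer.
  obtain ⟨e, he⟩ : ∃ e : Fin (2 * d) → A, Function.Surjective e := by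
    have : Nonempty A := ⟨⟨a₀, ha₀⟩⟩
    obtain ⟨g⟩ : Nonempty (A ↪ Fin (2 * d)) :=
      Function.Embedding.nonempty_of_card_le (by simpa using hcard)
    exact ⟨Function.invFun g, Function.invFun_surjective g.injective⟩
  -- `v₀` only serves to single out the partite class; it is the midpoint of a closed to-and-fro
  -- walk at `F a₀`.
  obtain ⟨v₀, hv₀⟩ : ∃ v, H.HasWalk (F a₀) v (l1Dist a₀ b) := by
    have h := (SimpleGraph.HasWalk.refl H (F a₀)).add_even hH (l1Dist a₀ b)
    rw [zero_add, two_mul] at h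
    obtain ⟨x, hx, -⟩ := h.split
    exact ⟨x, hx⟩
  -- The class of `v₀` has the right parity with respect to every `a ∈ A`, not just `a₀`.
  have hcol : ∀ a ∈ A, ∀ x, Even (l1Dist a b) ↔ (c (F a) = c x ↔ c x = c v₀) := by
    intro a ha x
    have h₁ := (hA a ha a₀ ha₀).even_iff c
    have h₂ := hv₀.even_iff c
    have h₃ := even_l1Dist_add a a₀ b
    rw [Nat.even_add, Nat.even_add, h₁, h₂] at h₃
    rw [h₃]
    generalize c (F a) = p
    generalize c (F a₀) = q
    generalize c v₀ = s
    generalize c x = t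
    omega
  obtain ⟨v, hv, hvr⟩ := hHelly c (c v₀) (fun i => F (e i)) (fun i => l1Dist (e i).1 b)
    (fun i => Nat.one_le_iff_ne_zero.2 fun h => hb (l1Dist_eq_zero.1 h ▸ (e i).2)) (by
      intro I hI
      obtain ⟨i, j, -, rfl⟩ := Finset.card_eq_two.1 hI
      -- The detour through `b` has the parity of the direct distance, so the walk between the two
      -- values can be prolonged to the sum of the radii and cut at the first radius.
      obtain ⟨x, hx, hx'⟩ := ((hA _ (e i).2 _ (e j).2).of_le hH (l1Dist_triangle _ b _)
        (even_l1Dist_add _ b _)).split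
      refine ⟨x, ?_, ?_⟩
      · have h₁ := hx.even_iff c
        have h₂ := hcol _ (e i).2 x
        change c x = c v₀
        tauto
      · intro l hl
        rw [Finset.mem_insert, Finset.mem_singleton] at hl
        rcases hl with rfl | rfl
        · exact hx.dist_le
        · rw [l1Dist_comm]
          exact hx'.symm.dist_le)
  refine ⟨v, fun a ha => ?_⟩
  obtain ⟨i, hi⟩ := he ⟨a, ha⟩
  have h₁ := hvr i
  rw [hi] at h₁
  refine (hH.hasWalk_dist _ _).of_le hH h₁ ?_
  have hv : c v = c v₀ := hv
  rw [Nat.even_add, (hH.hasWalk_dist (F a) v).even_iff c, hcol a ha v]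
  tauto

open Classical in
/-- Among more than `2d` points of `ℤ^d` there is one which in no coordinate is the only minimum
or the only maximum. -/
theorem exists_not_extreme {A : Finset (Fin d → ℤ)} (hA : 2 * d < A.card) :
    ∃ a ∈ A, ∀ i, (∃ p ∈ A, p ≠ a ∧ p i ≤ a i) ∧ ∃ q ∈ A, q ≠ a ∧ a i ≤ q i := by
  have hne : A.Nonempty := Finset.card_pos.1 (by omega)
  choose p hp hp' using fun i : Fin d => A.exists_min_image (fun a => a i) hne
  choose q hq hq' using fun i : Fin d => A.exists_max_image (fun a => a i) hne
  -- One minimiser and one maximiser per coordinate make at most `2 * d` points, so some `a` is none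
  -- of them.
  obtain ⟨a, ha, ha'⟩ : ∃ a ∈ A, a ∉ Finset.univ.image p ∪ Finset.univ.image q := by
    by_contra! h
    have h₁ := Finset.card_le_card (show A ⊆ _ from h)
    have h₂ := Finset.card_union_le (Finset.univ.image p) (Finset.univ.image q)
    have h₃ := Finset.card_image_le (s := Finset.univ) (f := p)
    have h₄ := Finset.card_image_le (s := Finset.univ) (f := q)
    rw [Finset.card_univ, Fintype.card_fin] at h₃ h₄
    omega
  simp only [Finset.mem_union, Finset.mem_image, Finset.mem_univ, true_and, not_or, not_exists] at ha'
  exact ⟨a, ha, fun i => ⟨⟨p i, hp i, ha'.1 i, hp' i a ha⟩, q i, hq i, ha'.2 i, hq' i a ha⟩⟩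

open Classical in
/-- The one-point extension.  If there are more than `2d` points, then one of them, `a`, is not
extreme, and one may extend along a geodesic from `a` to `b`: a value at the next to last point
takes care of two of the given points. -/
theorem IsBipartiteHelly.exists_extension_point [Nontrivial V] (hH : H.Connected)
    (hHelly : IsBipartiteHelly H (2 * d) 2) {A : Finset (Fin d → ℤ)} {F : (Fin d → ℤ) → V}
    (hA : WalkCompatible H A F) (b : Fin d → ℤ) :
    ∃ v, ∀ a ∈ A, H.HasWalk (F a) v (l1Dist a b) := by
  induction hm : A.card using Nat.strong_induction_on generalizing A F b with
  | _ m ih =>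
  subst hm
  by_cases hcard : A.card ≤ 2 * d
  · exact hHelly.exists_of_card_le hH hA hcard b
  obtain ⟨a, ha, hext⟩ := exists_not_extreme (not_le.1 hcard)
  -- Inner induction on the distance from `b` to `a`, with `A` and `a` fixed.
  induction hr : l1Dist b a generalizing b with
  | zero =>
    obtain rfl := l1Dist_eq_zero.1 hr
    exact ⟨F b, fun a ha' => hA a ha' b ha⟩
  | succ r ihr =>
    obtain ⟨i, hi⟩ : ∃ i, b i ≠ a i := by
      by_contra! hxy
      rw [l1Dist_eq_zero.2 (funext hxy)] at hr
      omega
    obtain ⟨c, hc, hcb, hcd⟩ := exists_unit_step hi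
    -- In coordinate `i`, `q` is at or beyond `a` as seen from `b`, so the step towards `a` also
    -- approaches `q`.
    obtain ⟨q, hq, hqa, hqi⟩ : ∃ q ∈ A, q ≠ a ∧ (c - q i).natAbs + 1 = (b i - q i).natAbs := by
      obtain ⟨⟨p, hp, hpa, hpi⟩, q, hq, hqa, hqi⟩ := hext i
      rcases hcb with h | h
      · exact ⟨q, hq, hqa, by omega⟩
      · exact ⟨p, hp, hpa, by omega⟩
    set b' := Function.update b i c with hb'
    have hua := l1Dist_update b a i c
    have huq := l1Dist_update b q i c
    rw [← hb'] at hua huq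
    obtain ⟨w, hw⟩ := ihr b' (by omega)
    have hbb' : l1Dist b' b = 1 := by
      rw [l1Dist_comm]
      exact l1Dist_of_adj (latticeGraph_adj_update b i hc)
    -- Two points leave and at most `b'` enters, so the outer induction applies.
    set A' := (A.erase a).erase q with hA'
    have hsub : A' ⊆ A := (Finset.erase_subset _ _).trans (Finset.erase_subset _ _)
    have hq' : q ∈ A.erase a := Finset.mem_erase.2 ⟨hqa, hq⟩
    have hA'card : A'.card + 2 = A.card := by
      have h₁ := Finset.card_erase_add_one ha
      have h₂ := Finset.card_erase_add_one hq'
      rw [← hA'] at h₂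
      omega
    obtain ⟨v, hv, hvb⟩ : ∃ v, (∀ x ∈ A', H.HasWalk (F x) v (l1Dist x b)) ∧ H.HasWalk w v 1 := by
      -- If `b'` is already prescribed, the walk of length `0` forces `w = F b'`, and nothing has to
      -- be inserted.
      by_cases hmem : b' ∈ A'
      · obtain ⟨v, hv⟩ := ih A'.card (by omega) (hA.mono hsub) b rfl
        refine ⟨v, hv, ?_⟩
        have h := hw b' (hsub hmem)
        rw [l1Dist_self, SimpleGraph.hasWalk_zero] at h
        rw [← h, ← hbb']
        exact hv b' hmem
      · obtain ⟨v, hv⟩ := ih (insert b' A').card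
          (by rw [Finset.card_insert_of_notMem hmem]; omega)
          ((hA.mono hsub).insert (fun x hx => hw x (hsub hx)) hmem) b rfl
        refine ⟨v, fun x hx => ?_, ?_⟩
        · have h := hv x (Finset.mem_insert_of_mem hx)
          rwa [Function.update_of_ne (by rintro rfl; exact hmem hx)] at h
        · have h := hv b' (Finset.mem_insert_self _ _)
          rwa [Function.update_self, hbb'] at h
    refine ⟨v, fun x hx => ?_⟩
    have key : ∀ x ∈ A, l1Dist b' x + 1 = l1Dist b x → H.HasWalk (F x) v (l1Dist x b) := by
      intro x hx hxb
      rw [l1Dist_comm, ← hxb, l1Dist_comm]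
      exact (hw x hx).trans hvb
    by_cases hxq : x = q
    · subst hxq
      exact key x hx (by omega)
    by_cases hxa : x = a
    · subst hxa
      exact key x hx (by omega)
    exact hv x (Finset.mem_erase.2 ⟨hxq, Finset.mem_erase.2 ⟨hxa, hx⟩⟩)

open Classical in
theorem IsBipartiteHelly.exists_extension [Nontrivial V] (hH : H.Connected)
    (hHelly : IsBipartiteHelly H (2 * d) 2) {A : Finset (Fin d → ℤ)} {F : (Fin d → ℤ) → V}
    (hA : WalkCompatible H A F) (B : Finset (Fin d → ℤ)) :
    ∃ G, (∀ a ∈ A, G a = F a) ∧ WalkCompatible H (A ∪ B) G := by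
  induction B using Finset.induction_on with
  | empty => exact ⟨F, fun _ _ => rfl, by simpa using hA⟩
  | insert b B _ ih =>
    obtain ⟨G, hG, hGc⟩ := ih
    rw [Finset.union_insert]
    by_cases hb : b ∈ A ∪ B
    · rw [Finset.insert_eq_of_mem hb]
      exact ⟨G, hG, hGc⟩
    · obtain ⟨v, hv⟩ := hHelly.exists_extension_point hH hGc b
      refine ⟨Function.update G b v, fun a ha => ?_, hGc.insert hv hb⟩
      rw [Function.update_of_ne, hG a ha]
      rintro rfl
      exact hb (Finset.mem_union_left _ ha)

/-! ### The extension criterion on the boundary, connectedness and parity. -/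

variable {n : ℕ} (f : boundaryGraph d n →g H)

/-- The values of `f` at any two points are joined by a walk whose length is the distance of
the points. -/
def BoundaryWalks : Prop :=
  ∀ x y : boxBoundary d n, H.HasWalk (f x) (f y) (l1Dist x.1 y.1)

variable {f}

theorem ExtendsToBox.boundaryWalks (h : ExtendsToBox f) : BoundaryWalks f := by
  obtain ⟨g, hg⟩ := h
  intro x y
  rw [← hg, ← hg]
  exact (boxGraph_hasWalk (⟨x.1, x.2.1⟩ : box d n) ⟨y.1, y.2.1⟩).map g

theorem extendsToBox_of_box_subset (h : box d n ⊆ boxBoundary d n) : ExtendsToBox f :=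
  ⟨⟨fun x => f ⟨x.1, h x.2⟩, fun hxy => f.map_rel hxy⟩, fun _ => rfl⟩

theorem extendsToBox_of_eq_zero (hd : 1 ≤ d) (hn : n = 0) : ExtendsToBox f := by
  refine extendsToBox_of_box_subset fun x hx => ⟨hx, ⟨0, hd⟩, Or.inl ?_⟩
  have := hx ⟨0, hd⟩
  omega

theorem const_mem_boxBoundary (hd : 1 ≤ d) (n : ℕ) {c : ℕ} (hc : c = 0 ∨ c = n) :
    (fun _ => (c : ℤ)) ∈ boxBoundary d n :=
  ⟨fun _ => by dsimp only; omega, ⟨0, hd⟩, by dsimp only; omega⟩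

open Classical in
theorem BoundaryWalks.extendsToBox (hd : 1 ≤ d) (hH : H.Connected)
    (hHelly : IsBipartiteHelly H (2 * d) 2) (h : BoundaryWalks f) : ExtendsToBox f := by
  -- A one-vertex graph has no walk of positive length, so opposite corners of the box coincide and
  -- `n = 0`.
  rcases subsingleton_or_nontrivial V with hV | hV
  · refine extendsToBox_of_eq_zero hd ?_
    have h₀ := const_mem_boxBoundary hd n (c := 0) (Or.inl rfl)
    have hn := const_mem_boxBoundary hd n (Or.inr rfl)
    have := congrFun (l1Dist_eq_zero.1 (h ⟨_, h₀⟩ ⟨_, hn⟩).eq_zero) ⟨0, hd⟩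
    simpa using this.symm
  · set B := Finset.Icc (0 : Fin d → ℤ) (fun _ => (n : ℤ)) with hB
    have hmem : ∀ x, x ∈ B ↔ x ∈ box d n := fun x => by
      simp [hB, box, Pi.le_def, forall_and]
    set F : (Fin d → ℤ) → V :=
      fun x => if hx : x ∈ boxBoundary d n then f ⟨x, hx⟩ else Classical.arbitrary V with hF
    have hFx : ∀ x : boxBoundary d n, F x = f x := fun x => by simp [hF]
    obtain ⟨G, hG, hGc⟩ := hHelly.exists_extension hH (A := B.filter (· ∈ boxBoundary d n)) (F := F)
      (by
        intro a ha b hb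
        have ha' := (Finset.mem_filter.1 ha).2
        have hb' := (Finset.mem_filter.1 hb).2
        simpa only [← hFx] using h ⟨a, ha'⟩ ⟨b, hb'⟩) B
    refine ⟨⟨fun x => G x, fun {x y} hxy => ?_⟩, fun x => ?_⟩
    · rw [← SimpleGraph.hasWalk_one, ← l1Dist_of_adj (show (latticeGraph d).Adj x.1 y.1 from hxy)]
      exact hGc x.1 (Finset.mem_union_right _ ((hmem _).2 x.2)) y.1
        (Finset.mem_union_right _ ((hmem _).2 y.2))
    · exact (hG x.1 (Finset.mem_filter.2 ⟨(hmem _).2 x.2.1, x.2⟩)).trans (hFx x)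

theorem extendsToBox_iff_boundaryWalks (hd : 1 ≤ d) (hH : H.Connected)
    (hHelly : IsBipartiteHelly H (2 * d) 2) : ExtendsToBox f ↔ BoundaryWalks f :=
  ⟨fun h => h.boundaryWalks, fun h => h.extendsToBox hd hH hHelly⟩

/-- If the coordinate `i` of `x` keeps it on the boundary, then any other coordinate can be changed
along a path in the boundary. -/
theorem boundaryGraph_reachable_update {x : Fin d → ℤ} (hx : x ∈ box d n) {i j : Fin d} (hij : j ≠ i)
    (hi : x i = 0 ∨ x i = n) (c : ℕ) (hc : c ≤ n)
    (hxb : x ∈ boxBoundary d n) (hxb' : Function.update x j (c : ℤ) ∈ boxBoundary d n) :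
    (boundaryGraph d n).Reachable ⟨x, hxb⟩ ⟨_, hxb'⟩ := by
  have hmem : ∀ c' : ℕ, c' ≤ n → Function.update x j (c' : ℤ) ∈ boxBoundary d n := by
    intro c' hc'
    refine ⟨fun l => ?_, i, by rwa [Function.update_of_ne hij.symm]⟩
    obtain rfl | hl := eq_or_ne l j
    · rw [Function.update_self]
      omega
    · rw [Function.update_of_ne hl]
      exact hx l
  -- Both points are joined to the one whose coordinate `j` is `0`.
  have key : ∀ c' (hc' : c' ≤ n), (boundaryGraph d n).Reachable ⟨_, hmem 0 (by omega)⟩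
      ⟨_, hmem c' hc'⟩ := by
    intro c' hc'
    induction c' with
    | zero => exact .refl _
    | succ k ih =>
      refine (ih (by omega)).trans (SimpleGraph.Adj.reachable ?_)
      have h := latticeGraph_adj_update (Function.update x j (k : ℤ)) j (c := ((k + 1 : ℕ) : ℤ))
        (Or.inl (by simp))
      rw [Function.update_idem] at h
      exact h
  have hxj := hx j
  have h₁ := key (x j).toNat (by omega)
  have h₂ := key c hc
  have h₃ : (⟨_, hmem (x j).toNat (by omega)⟩ : boxBoundary d n) = ⟨x, hxb⟩ := by
    apply Subtype.ext
    dsimp only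
    rw [Int.toNat_of_nonneg hxj.1, Function.update_eq_self]
  rw [h₃] at h₁
  exact h₁.symm.trans h₂

open Classical in
-- A coordinate `i` equal to `0` or `n` allows all others to be moved to `0`. These then keep the
-- point on the boundary while coordinate `i` itself is moved, which needs a second coordinate. Each
-- move lowers the number of nonzero coordinates.
theorem boundaryGraph_reachable_zero (hd : 2 ≤ d) (x : boxBoundary d n)
    (h₀ : (fun _ => ((0 : ℕ) : ℤ)) ∈ boxBoundary d n) :
    (boundaryGraph d n).Reachable x ⟨_, h₀⟩ := by
  induction hr : (Finset.univ.filter fun i => x.1 i ≠ 0).card using Nat.strong_induction_on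
    generalizing x with
  | _ r ih =>
  have step : ∀ i j : Fin d, j ≠ i → x.1 i = 0 ∨ x.1 i = n → x.1 j ≠ 0 →
      (boundaryGraph d n).Reachable x ⟨_, h₀⟩ := by
    intro i j hij hi hj
    have hmem : Function.update x.1 j ((0 : ℕ) : ℤ) ∈ boxBoundary d n := by
      refine ⟨fun l => ?_, j, by simp⟩
      obtain rfl | hl := eq_or_ne l j
      · simp
      · rw [Function.update_of_ne hl]
        exact x.2.1 l
    refine (boundaryGraph_reachable_update x.2.1 hij hi 0 (by omega) x.2 hmem).trans
      (ih _ ?_ ⟨_, hmem⟩ rfl)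
    rw [← hr]
    refine Finset.card_lt_card (Finset.ssubset_iff_of_subset ?_ |>.2 ⟨j, by simpa using hj, by simp⟩)
    intro l
    simp only [Finset.mem_filter, Finset.mem_univ, true_and]
    intro hl
    obtain rfl | hlj := eq_or_ne l j
    · simp at hl
    · rwa [Function.update_of_ne hlj] at hl
  obtain ⟨i, hi⟩ := x.2.2
  by_cases h : ∃ j, j ≠ i ∧ x.1 j ≠ 0
  · obtain ⟨j, hji, hj⟩ := h
    exact step i j hji hi hj
  push Not at h
  by_cases hxi : x.1 i = 0
  · have : x = ⟨_, h₀⟩ := by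
      apply Subtype.ext
      funext j
      by_cases hj : j = i
      · rw [hj, hxi]; rfl
      · exact h j hj
    rw [this]
  · have : Nontrivial (Fin d) := Fin.nontrivial_iff_two_le.2 hd
    obtain ⟨j, hj⟩ := exists_ne i
    exact step j i hj.symm (Or.inl (h j hj)) hxi

/-- The length of the boundary walk has the parity of the ℓ¹ distance, and `f` maps it to a walk of
the same length. -/
theorem even_l1Dist_iff_of_boundary_walk (c : H.Coloring (Fin 2)) {x y : boxBoundary d n}
    (p : (boundaryGraph d n).Walk x y) : Even (l1Dist x.1 y.1) ↔ c (f x) = c (f y) := by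
  have h₁ := (SimpleGraph.HasWalk.map ⟨p, rfl⟩ f).even_iff c
  rw [← h₁]
  clear h₁
  induction p with
  | nil => simp [l1Dist_self]
  | @cons u v w huv p ih =>
    have h := even_l1Dist_add u.1 v.1 w.1
    rw [l1Dist_of_adj (show (latticeGraph d).Adj u.1 v.1 from huv)] at h
    have ih' : Even (l1Dist v.1 w.1) ↔ Even p.length := ih
    rw [SimpleGraph.Walk.length_cons, Nat.even_add_one, ← ih']
    simpa [Nat.even_add] using h

theorem boundaryWalks_iff_isOneLipschitz_and [Nontrivial V] (hH : H.Connected) (hb : H.IsBipartite) :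
    BoundaryWalks f ↔ IsOneLipschitz f ∧ ∀ x y : boxBoundary d n,
      Even (H.dist (f x) (f y) + (latticeGraph d).dist x.1 y.1) := by
  simp only [BoundaryWalks, IsOneLipschitz, SimpleGraph.hasWalk_iff hH hb,
    fun x y : boxBoundary d n => latticeGraph_dist_eq x.2.1 y.2.1, forall_and]

theorem boundaryWalks_iff_isOneLipschitz [Nontrivial V] (hd : 2 ≤ d) (hH : H.Connected)
    (hb : H.IsBipartite) : BoundaryWalks f ↔ IsOneLipschitz f := by
  rw [boundaryWalks_iff_isOneLipschitz_and hH hb, and_iff_left_iff_imp]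
  rintro - x y
  obtain ⟨c⟩ := hb
  have h₀ := const_mem_boxBoundary (d := d) (by omega) n (c := 0) (Or.inl rfl)
  obtain ⟨p⟩ := (boundaryGraph_reachable_zero hd x h₀).trans
    (boundaryGraph_reachable_zero hd y h₀).symm
  rw [latticeGraph_dist_eq x.2.1 y.2.1, Nat.even_add, (hH.hasWalk_dist _ _).even_iff c,
    even_l1Dist_iff_of_boundary_walk c p]

theorem extendsToBox_iff_isOneLipschitz (hd : 2 ≤ d) (hH : H.Connected)
    (hHelly : IsBipartiteHelly H (2 * d) 2) : ExtendsToBox f ↔ IsOneLipschitz f := by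
  have h₁ : 1 ≤ d := by omega
  rcases Nat.eq_zero_or_pos n with hn | hn
  · have h : ExtendsToBox f := extendsToBox_of_eq_zero h₁ hn
    refine iff_of_true h fun x y => ?_
    rw [latticeGraph_dist_eq x.2.1 y.2.1]
    exact (h.boundaryWalks x y).dist_le
  · have h₀ := const_mem_boxBoundary h₁ n (c := 0) (Or.inl rfl)
    -- Since another coordinate stays `0`, this neighbour of the origin is on the boundary; the
    -- image of the edge shows that `H` has two vertices.
    have hmem : Function.update (fun _ => ((0 : ℕ) : ℤ)) (⟨0, h₁⟩ : Fin d) 1 ∈ boxBoundary d n := by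
      refine ⟨fun l => ?_, ⟨1, hd⟩, Or.inl (by simp)⟩
      rw [Function.update_apply]
      split_ifs <;> simp
      omega
    have hadj : (boundaryGraph d n).Adj ⟨_, h₀⟩ ⟨_, hmem⟩ :=
      latticeGraph_adj_update _ _ (Or.inl rfl)
    have : Nontrivial V := ⟨_, _, (f.map_rel hadj).ne⟩
    rw [extendsToBox_iff_boundaryWalks h₁ hH hHelly, boundaryWalks_iff_isOneLipschitz hd hH hHelly.1]

end Extension

/-! ### Composable machine code with running times. -/

namespace RAM

/-- A piece of code that leaves its result in a given register `R_k`, uses only the registers from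
`R_k` on, and reads registers below `R_k`. -/
abbrev Code : Type := ℕ → Program

/-- Started with the memory `M` and with the values listed in `Γ` in registers, `e` halts within
`T` steps with the memory `M'` and the result `v`. -/
def Runs (e : Code) (M : ℕ → ℕ) (Γ : List (ℕ × ℕ)) (T : ℕ) (M' : ℕ → ℕ) (v : ℕ) : Prop :=
  ∀ (k : ℕ) (s : State), s.mem = M → (∀ p ∈ Γ, p.1 < k ∧ s.reg p.1 = p.2) →
    ∃ t ≤ T, ∃ s', Exec (e k) s t s' ∧ s'.mem = M' ∧ (∀ i < k, s'.reg i = s.reg i) ∧ s'.reg k = v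

namespace Code

def numeral (c : ℕ) : Code := fun k => .const k c

def var (r : ℕ) : Code := fun k => .seq (.const k 0) (.add k r k)

def plus (a b : Code) : Code := fun k => .seq (a k) (.seq (b (k + 1)) (.add k k (k + 1)))

def minus (a b : Code) : Code := fun k => .seq (a k) (.seq (b (k + 1)) (.sub k k (k + 1)))

/-- The content of the memory at the address `a`. -/
def read (a : Code) : Code := fun k => .seq (a k) (.load k k)

/-- Writes `b` to the memory at the address `a`. -/
def write (a b : Code) : Code := fun k => .seq (a k) (.seq (b (k + 1)) (.store k (k + 1)))

def cond (c a b : Code) : Code := fun k => .seq (c k) (.ite k (a k) (b k))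

def andThen (a b : Code) : Code := fun k => .seq (a k) (b k)

/-- Iterates `body i x` for `i = 0, …, b - 1`, where `x` is the result of the previous iteration,
starting with `a`.  The arguments of `body` are the registers of `i` and `x`. -/
def fold (b a : Code) (body : ℕ → ℕ → Code) : Code := fun k =>
  .seq (b k) (.seq (.const (k + 1) 0) (.seq (a (k + 2)) (.seq
    (.loop k (.seq (body (k + 1) (k + 2) (k + 3)) (.seq (.const (k + 2) 0)
      (.seq (.add (k + 2) (k + 2) (k + 3)) (.seq (.const (k + 3) 1)
        (.seq (.add (k + 1) (k + 1) (k + 3)) (.sub k k (k + 3))))))))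
    (.seq (.const k 0) (.add k k (k + 2))))))

def times (a b : Code) : Code := fold b (numeral 0) fun _ x => plus (var x) a

def equal (a b : Code) : Code := cond (plus (minus a b) (minus b a)) (numeral 0) (numeral 1)

def forallLt (b : Code) (body : ℕ → Code) : Code :=
  fold b (numeral 1) fun i x => cond (body i) (var x) (numeral 0)

def existsLt (b : Code) (body : ℕ → Code) : Code :=
  fold b (numeral 0) fun i x => cond (body i) (numeral 1) (var x)

def forLt (b : Code) (body : ℕ → Code) : Code :=
  fold b (numeral 0) fun i _ => andThen (body i) (numeral 0)

end Code

open Code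

variable {e e₁ e₂ e₃ : Code} {M M₁ M₂ M₃ : ℕ → ℕ} {Γ Γ' : List (ℕ × ℕ)} {T T₁ T₂ T₃ v v₁ v₂ v₃ : ℕ}

theorem Runs.mono_context (h : Runs e M Γ T M₁ v) (hΓ : Γ ⊆ Γ') : Runs e M Γ' T M₁ v :=
  fun k s hs hp => h k s hs fun p hpΓ => hp p (hΓ hpΓ)

theorem Runs.congr_value (h : Runs e M Γ T M₁ v) (hv : v = v₁) : Runs e M Γ T M₁ v₁ := hv ▸ h

theorem runs_numeral (c : ℕ) : Runs (numeral c) M Γ 1 M c := by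
  intro k s hs _
  refine ⟨1, le_rfl, _, .const k c s, hs, fun i hi => ?_, ?_⟩
  · exact Function.update_of_ne hi.ne _ _
  · exact Function.update_self _ _ _

theorem runs_var {r : ℕ} (h : (r, v) ∈ Γ) : Runs (var r) M Γ 2 M v := by
  intro k s hs hp
  obtain ⟨hrk, hr⟩ := hp _ h
  refine ⟨1 + 1, le_rfl, _, .seq (.const k 0 s) (.add k r k _), hs, fun i hi => ?_, ?_⟩
  · dsimp only
    rw [Function.update_of_ne hi.ne, Function.update_of_ne hi.ne]
  · dsimp only at hrk hr ⊢
    rw [Function.update_self, Function.update_self, Function.update_of_ne hrk.ne, hr, add_zero]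

/-- Two pieces of code run in a row, with the results in consecutive registers. -/
theorem Runs.pair (h₁ : Runs e₁ M Γ T₁ M₁ v₁) (h₂ : Runs e₂ M₁ Γ T₂ M₂ v₂) (k : ℕ) (s : State)
    (hs : s.mem = M) (hp : ∀ p ∈ Γ, p.1 < k ∧ s.reg p.1 = p.2) :
    ∃ t₁ t₂, t₁ + t₂ ≤ T₁ + T₂ ∧ ∃ s₁ s₂, Exec (e₁ k) s t₁ s₁ ∧ Exec (e₂ (k + 1)) s₁ t₂ s₂ ∧
      s₂.mem = M₂ ∧ (∀ i < k, s₂.reg i = s.reg i) ∧ s₂.reg k = v₁ ∧ s₂.reg (k + 1) = v₂ := by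
  obtain ⟨t₁, ht₁, s₁, hex₁, hm₁, hr₁, hv₁⟩ := h₁ k s hs hp
  obtain ⟨t₂, ht₂, s₂, hex₂, hm₂, hr₂, hv₂⟩ := h₂ (k + 1) s₁ hm₁ fun p hpΓ =>
    ⟨(hp p hpΓ).1.trans (Nat.lt_succ_self k), by rw [hr₁ _ (hp p hpΓ).1, (hp p hpΓ).2]⟩
  refine ⟨t₁, t₂, add_le_add ht₁ ht₂, s₁, s₂, hex₁, hex₂, hm₂, fun i hi => ?_, ?_, hv₂⟩
  · rw [hr₂ i (by omega), hr₁ i hi]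
  · rw [hr₂ k (by omega), hv₁]

theorem Runs.plus (h₁ : Runs e₁ M Γ T₁ M₁ v₁) (h₂ : Runs e₂ M₁ Γ T₂ M₂ v₂) :
    Runs (plus e₁ e₂) M Γ (T₁ + T₂ + 1) M₂ (v₁ + v₂) := by
  intro k s hs hp
  obtain ⟨t₁, t₂, ht, s₁, s₂, hex₁, hex₂, hm, hr, hv₁, hv₂⟩ := h₁.pair h₂ k s hs hp
  refine ⟨t₁ + (t₂ + 1), by omega, _, .seq hex₁ (.seq hex₂ (.add k k (k + 1) s₂)), hm,
    fun i hi => ?_, ?_⟩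
  · dsimp only
    rw [Function.update_of_ne hi.ne, hr i hi]
  · dsimp only
    rw [Function.update_self, hv₁, hv₂]

theorem Runs.minus (h₁ : Runs e₁ M Γ T₁ M₁ v₁) (h₂ : Runs e₂ M₁ Γ T₂ M₂ v₂) :
    Runs (minus e₁ e₂) M Γ (T₁ + T₂ + 1) M₂ (v₁ - v₂) := by
  intro k s hs hp
  obtain ⟨t₁, t₂, ht, s₁, s₂, hex₁, hex₂, hm, hr, hv₁, hv₂⟩ := h₁.pair h₂ k s hs hp
  refine ⟨t₁ + (t₂ + 1), by omega, _, .seq hex₁ (.seq hex₂ (.sub k k (k + 1) s₂)), hm,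
    fun i hi => ?_, ?_⟩
  · dsimp only
    rw [Function.update_of_ne hi.ne, hr i hi]
  · dsimp only
    rw [Function.update_self, hv₁, hv₂]

theorem Runs.read (h : Runs e M Γ T M₁ v) : Runs (read e) M Γ (T + 1) M₁ (M₁ v) := by
  intro k s hs hp
  obtain ⟨t, ht, s₁, hex, hm, hr, hv⟩ := h k s hs hp
  refine ⟨t + 1, by omega, _, .seq hex (.load k k s₁), hm, fun i hi => ?_, ?_⟩
  · dsimp only
    rw [Function.update_of_ne hi.ne, hr i hi]
  · dsimp only
    rw [Function.update_self, hv, hm]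

theorem Runs.write (h₁ : Runs e₁ M Γ T₁ M₁ v₁) (h₂ : Runs e₂ M₁ Γ T₂ M₂ v₂) :
    Runs (write e₁ e₂) M Γ (T₁ + T₂ + 1) (Function.update M₂ v₁ v₂) v₁ := by
  intro k s hs hp
  obtain ⟨t₁, t₂, ht, s₁, s₂, hex₁, hex₂, hm, hr, hv₁, hv₂⟩ := h₁.pair h₂ k s hs hp
  refine ⟨t₁ + (t₂ + 1), by omega, _, .seq hex₁ (.seq hex₂ (.store k (k + 1) s₂)), ?_, hr, hv₁⟩
  rw [hm, hv₁, hv₂]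

theorem Runs.andThen (h₁ : Runs e₁ M Γ T₁ M₁ v₁) (h₂ : Runs e₂ M₁ Γ T₂ M₂ v₂) :
    Runs (andThen e₁ e₂) M Γ (T₁ + T₂) M₂ v₂ := by
  intro k s hs hp
  obtain ⟨t₁, ht₁, s₁, hex₁, hm₁, hr₁, hv₁⟩ := h₁ k s hs hp
  obtain ⟨t₂, ht₂, s₂, hex₂, hm₂, hr₂, hv₂⟩ := h₂ k s₁ hm₁ fun p hpΓ =>
    ⟨(hp p hpΓ).1, by rw [hr₁ _ (hp p hpΓ).1, (hp p hpΓ).2]⟩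
  exact ⟨t₁ + t₂, by omega, s₂, .seq hex₁ hex₂, hm₂, fun i hi => by rw [hr₂ i hi, hr₁ i hi], hv₂⟩

theorem Runs.cond (h₁ : Runs e₁ M Γ T₁ M₁ v₁) (h₂ : v₁ ≠ 0 → Runs e₂ M₁ Γ T₂ M₂ v₂)
    (h₃ : v₁ = 0 → Runs e₃ M₁ Γ T₃ M₂ v₃) :
    Runs (cond e₁ e₂ e₃) M Γ (T₁ + (T₂ + T₃ + 1)) M₂ (if v₁ ≠ 0 then v₂ else v₃) := by
  intro k s hs hp
  obtain ⟨t₁, ht₁, s₁, hex₁, hm₁, hr₁, hv₁⟩ := h₁ k s hs hp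
  have hp₁ : ∀ p ∈ Γ, p.1 < k ∧ s₁.reg p.1 = p.2 := fun p hpΓ =>
    ⟨(hp p hpΓ).1, by rw [hr₁ _ (hp p hpΓ).1, (hp p hpΓ).2]⟩
  by_cases hv : v₁ ≠ 0
  · obtain ⟨t₂, ht₂, s₂, hex₂, hm₂, hr₂, hv₂⟩ := h₂ hv k s₁ hm₁ hp₁
    rw [if_pos hv]
    exact ⟨t₁ + (t₂ + 1), by omega, s₂, .seq hex₁ (.ite_pos (hv₁ ▸ hv) hex₂), hm₂,
      fun i hi => by rw [hr₂ i hi, hr₁ i hi], hv₂⟩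
  · rw [if_neg hv]
    rw [not_not] at hv
    obtain ⟨t₂, ht₂, s₂, hex₂, hm₂, hr₂, hv₂⟩ := h₃ hv k s₁ hm₁ hp₁
    exact ⟨t₁ + (t₂ + 1), by omega, s₂, .seq hex₁ (.ite_zero (hv₁ ▸ hv) hex₂), hm₂,
      fun i hi => by rw [hr₂ i hi, hr₁ i hi], hv₂⟩

/-- `m i` and `a i` are the memory and the accumulator after `i` iterations. The body must run in
every larger context, so that loops can be nested. The `6` is five bookkeeping instructions and one
test. -/
theorem Runs.fold {b : ℕ} {m : ℕ → ℕ → ℕ} {a : ℕ → ℕ} {body : ℕ → ℕ → Code}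
    (h₁ : Runs e₁ M Γ T₁ M₁ b) (h₂ : Runs e₂ M₁ Γ T₂ (m 0) (a 0))
    (h : ∀ i < b, ∀ r r' Γ', Γ ⊆ Γ' → (r, i) ∈ Γ' → (r', a i) ∈ Γ' →
      Runs (body r r') (m i) Γ' T (m (i + 1)) (a (i + 1))) :
    Runs (fold e₁ e₂ body) M Γ (T₁ + T₂ + b * (T + 6) + 4) (m b) (a b) := by
  intro k s hs hp
  obtain ⟨t₁, ht₁, s₁, hex₁, hm₁, hr₁, hv₁⟩ := h₁ k s hs hp
  obtain ⟨t₂, ht₂, s₂, hex₂, hm₂, hr₂, hv₂⟩ := h₂ (k + 2)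
    ⟨Function.update s₁.reg (k + 1) 0, s₁.mem⟩ hm₁ fun p hpΓ => by
      obtain ⟨hpk, hpr⟩ := hp p hpΓ
      refine ⟨by omega, ?_⟩
      dsimp only
      rw [Function.update_of_ne (by omega), hr₁ _ hpk, hpr]
  -- Loop invariant, with `j` iterations left: register `k` counts down, `k + 1` holds the index and
  -- `k + 2` the accumulator.
  have hloop : ∀ (j : ℕ) (s : State), j ≤ b → s.mem = m (b - j) →
      (∀ p ∈ Γ, p.1 < k ∧ s.reg p.1 = p.2) → s.reg k = j → s.reg (k + 1) = b - j →
      s.reg (k + 2) = a (b - j) → ∃ t ≤ j * (T + 6) + 1, ∃ s', Exec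
      (.loop k (.seq (body (k + 1) (k + 2) (k + 3)) (.seq (.const (k + 2) 0)
      (.seq (.add (k + 2) (k + 2) (k + 3)) (.seq (.const (k + 3) 1)
        (.seq (.add (k + 1) (k + 1) (k + 3)) (.sub k k (k + 3)))))))) s t s' ∧ s'.mem = m b ∧
      (∀ i < k, s'.reg i = s.reg i) ∧ s'.reg (k + 2) = a b := by
    intro j
    induction j with
    | zero =>
      intro s _ hm _ hk _ hk₂
      exact ⟨1, by omega, s, .loop_zero hk, hm, fun _ _ => rfl, hk₂⟩
    | succ j ih =>
      intro s hj hm hp hk hk₁ hk₂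
      obtain ⟨t, ht, s', hex, hm', hr, hv⟩ := h (b - (j + 1)) (by omega) (k + 1) (k + 2)
        ((k + 1, b - (j + 1)) :: (k + 2, a (b - (j + 1))) :: Γ) (by simp) (by simp) (by simp)
        (k + 3) s hm (by
          simp only [List.mem_cons, forall_eq_or_imp]
          refine ⟨⟨by omega, hk₁⟩, ⟨by omega, hk₂⟩, fun p hpΓ => ?_⟩
          obtain ⟨hpk, hpr⟩ := hp p hpΓ
          exact ⟨by omega, hpr⟩)
      have hbj : b - (j + 1) + 1 = b - j := by omega
      rw [hbj] at hm' hv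
      set s'' : State := ⟨Function.update (Function.update (Function.update (Function.update
        (Function.update s'.reg (k + 2) 0) (k + 2) (a (b - j))) (k + 3) 1) (k + 1) (b - j)) k j,
        s'.mem⟩ with hs''
      have hex' : Exec (.seq (body (k + 1) (k + 2) (k + 3)) (.seq (.const (k + 2) 0)
          (.seq (.add (k + 2) (k + 2) (k + 3)) (.seq (.const (k + 3) 1)
          (.seq (.add (k + 1) (k + 1) (k + 3)) (.sub k k (k + 3))))))) s
          (t + (1 + (1 + (1 + (1 + 1))))) s'' := by
        convert Exec.seq hex (.seq (.const _ _ _) (.seq (.add _ _ _ _) (.seq (.const _ _ _)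
          (.seq (.add _ _ _ _) (.sub _ _ _ _))))) using 1
        rw [hs'']
        have h₁ := hr (k + 1) (by omega)
        have h₂ := hr k (by omega)
        simp [hv, h₁, h₂, hk, hk₁, hbj]
      obtain ⟨t', ht', s₃, hex₃, hm₃, hr₃, hv₃⟩ := ih s'' (by omega) hm' (fun p hpΓ => by
          obtain ⟨hpk, hpr⟩ := hp p hpΓ
          refine ⟨hpk, ?_⟩
          simp only [hs'']
          iterate 5 rw [Function.update_of_ne (by omega)]
          rw [hr _ (by omega), hpr])
        (by simp [hs'']) (by simp [hs'']) (by simp [hs''])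
      refine ⟨t + (1 + (1 + (1 + (1 + 1)))) + t' + 1, ?_, s₃,
        .loop_pos (by omega) hex' hex₃, hm₃, fun i hi => ?_, hv₃⟩
      · rw [add_mul]
        omega
      · rw [hr₃ i hi]
        simp only [hs'']
        iterate 5 rw [Function.update_of_ne (by omega)]
        rw [hr _ (by omega)]
  have hlow : ∀ i < k, s₂.reg i = s.reg i := fun i hi => by
    rw [hr₂ i (by omega)]
    dsimp only
    rw [Function.update_of_ne (by omega), hr₁ i hi]
  obtain ⟨t, ht, s₃, hex, hm, hr, hv⟩ := hloop b s₂ le_rfl (by simpa using hm₂)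
    (fun p hpΓ => ⟨(hp p hpΓ).1, by rw [hlow _ (hp p hpΓ).1, (hp p hpΓ).2]⟩)
    (by rw [hr₂ k (by omega)]; dsimp only; rw [Function.update_of_ne (by omega), hv₁])
    (by rw [hr₂ (k + 1) (by omega)]; simp) (by simpa using hv₂)
  refine ⟨t₁ + (1 + (t₂ + (t + (1 + 1)))), by omega, _, .seq hex₁ (.seq (.const _ _ _) (.seq hex₂
    (.seq hex (.seq (.const _ _ _) (.add _ _ _ _))))), hm, fun i hi => ?_, ?_⟩
  · dsimp only
    rw [Function.update_of_ne hi.ne, Function.update_of_ne hi.ne, hr i hi, hlow i hi]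
  · simp [hv]

theorem Runs.times (h₁ : Runs e₁ M Γ T₁ M v₁) (h₂ : Runs e₂ M Γ T₂ M v₂) :
    Runs (times e₁ e₂) M Γ (T₂ + 1 + v₂ * (2 + T₁ + 1 + 6) + 4) M (v₁ * v₂) :=
  Runs.fold (m := fun _ => M) (a := fun i => v₁ * i) h₂ (runs_numeral 0)
    fun _ _ _ _ _ hΓ _ hx => (runs_var hx).plus (h₁.mono_context hΓ)

theorem Runs.equal (h₁ : Runs e₁ M Γ T₁ M v₁) (h₂ : Runs e₂ M Γ T₂ M v₂) :
    Runs (equal e₁ e₂) M Γ (T₁ + T₂ + 1 + (T₂ + T₁ + 1) + 1 + (1 + 1 + 1)) M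
      (if v₁ = v₂ then 1 else 0) :=
  (((h₁.minus h₂).plus (h₂.minus h₁)).cond (fun _ => runs_numeral 0)
    fun _ => runs_numeral 1).congr_value (by split_ifs <;> omega)

theorem Runs.forallLt {b : ℕ} {body : ℕ → Code} {P : ℕ → Prop} [DecidablePred P]
    [Decidable (∀ i < b, P i)] (h₁ : Runs e₁ M Γ T₁ M b)
    (h : ∀ i < b, ∀ r Γ', Γ ⊆ Γ' → (r, i) ∈ Γ' →
      Runs (body r) M Γ' T M (if P i then 1 else 0)) :
    Runs (forallLt e₁ body) M Γ (T₁ + 1 + b * (T + (2 + 1 + 1) + 6) + 4) M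
      (if ∀ i < b, P i then 1 else 0) := by
  classical
  refine (Runs.fold (m := fun _ => M) (a := fun j => if ∀ i < j, P i then 1 else 0) h₁
    ((runs_numeral 1).congr_value (by simp)) fun i hi r r' Γ' hΓ hr hr' =>
      ((h i hi r Γ' hΓ hr).cond (fun _ => runs_var hr')
        fun _ => runs_numeral 0).congr_value ?_).congr_value ?_
  · simp only [Nat.lt_succ_iff_lt_or_eq, or_imp, forall_and, forall_eq]
    split_ifs <;> simp_all
  · congr

theorem Runs.existsLt {b : ℕ} {body : ℕ → Code} {P : ℕ → Prop} [DecidablePred P]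
    [Decidable (∃ i < b, P i)] (h₁ : Runs e₁ M Γ T₁ M b)
    (h : ∀ i < b, ∀ r Γ', Γ ⊆ Γ' → (r, i) ∈ Γ' →
      Runs (body r) M Γ' T M (if P i then 1 else 0)) :
    Runs (existsLt e₁ body) M Γ (T₁ + 1 + b * (T + (1 + 2 + 1) + 6) + 4) M
      (if ∃ i < b, P i then 1 else 0) := by
  classical
  refine (Runs.fold (m := fun _ => M) (a := fun j => if ∃ i < j, P i then 1 else 0) h₁
    ((runs_numeral 0).congr_value (by simp)) fun i hi r r' Γ' hΓ hr hr' =>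
      ((h i hi r Γ' hΓ hr).cond (fun _ => runs_numeral 1)
        fun _ => runs_var hr').congr_value ?_).congr_value ?_
  · simp only [Nat.lt_succ_iff_lt_or_eq, or_and_right, exists_or, exists_eq_left]
    by_cases hP : P i <;> simp [hP]
  · congr

theorem Runs.forLt {b : ℕ} {body : ℕ → Code} {m : ℕ → ℕ → ℕ} (h₁ : Runs e₁ M Γ T₁ (m 0) b)
    (h : ∀ i < b, ∀ r Γ', Γ ⊆ Γ' → (r, i) ∈ Γ' →
      ∃ v, Runs (body r) (m i) Γ' T (m (i + 1)) v) :
    Runs (forLt e₁ body) M Γ (T₁ + 1 + b * (T + 1 + 6) + 4) (m b) 0 :=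
  Runs.fold (a := fun _ => 0) h₁ (runs_numeral 0) fun i hi r _ Γ' hΓ hr _ =>
    (h i hi r Γ' hΓ hr).choose_spec.andThen (runs_numeral 0)

/-- `T n N` is at most a polynomial in `n + N`. -/
def PolyBounded (T : ℕ → ℕ → ℕ) : Prop :=
  ∃ p : Polynomial ℕ, ∀ n N, T n N ≤ p.eval (n + N)

theorem PolyBounded.const (c : ℕ) : PolyBounded fun _ _ => c :=
  ⟨Polynomial.C c, fun _ _ => by simp⟩

theorem PolyBounded.fst : PolyBounded fun n _ => n :=
  ⟨Polynomial.X, fun _ _ => by simp⟩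

theorem PolyBounded.snd : PolyBounded fun _ N => N :=
  ⟨Polynomial.X, fun _ _ => by simp⟩

theorem PolyBounded.add {S T : ℕ → ℕ → ℕ} (hS : PolyBounded S) (hT : PolyBounded T) :
    PolyBounded fun n N => S n N + T n N := by
  obtain ⟨p, hp⟩ := hS
  obtain ⟨q, hq⟩ := hT
  exact ⟨p + q, fun n N => by rw [Polynomial.eval_add]; exact add_le_add (hp n N) (hq n N)⟩

theorem PolyBounded.mul {S T : ℕ → ℕ → ℕ} (hS : PolyBounded S) (hT : PolyBounded T) :
    PolyBounded fun n N => S n N * T n N := by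
  obtain ⟨p, hp⟩ := hS
  obtain ⟨q, hq⟩ := hT
  exact ⟨p * q, fun n N => by rw [Polynomial.eval_mul]; exact Nat.mul_le_mul (hp n N) (hq n N)⟩

end RAM

/-! ### The decision program and its cost. -/

namespace RAM

namespace Code

/-- The side `n` of the box. -/
def side : Code := read (numeral 0)

/-- The number `N` of vertices of the target graph. -/
def order : Code := read (numeral 1)

/-- The address at which the table of the boundary values begins. -/
def tableStart : Code := plus (numeral 2) (times order order)

/-- `(n + 1) ^ j` -/
def sidePow : ℕ → Code
  | 0 => numeral 1
  | j + 1 => times (sidePow j) (plus side (numeral 1))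

/-- `(x N + y) N + z` -/
def triple (x y z : Code) : Code := plus (times (plus (times x order) y) order) z

/-- The address of the entry that tells whether there is a walk of length `x` from `y` to `z`. -/
def walkAddress (d : ℕ) (x y z : Code) : Code :=
  plus (plus tableStart (sidePow d)) (triple x y z)

/-- Tells whether there is a walk of length `t` from `u` to `v`, where `t`, `u`, `v` are
registers. -/
def walkEntry (d t u v : ℕ) : Code :=
  cond (var t)
    (existsLt order fun w =>
      cond (read (walkAddress d (minus (var t) (numeral 1)) (var u) (var w)))
        (read (plus (numeral 2) (plus (times (var w) order) (var v)))) (numeral 0))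
    (equal (var u) (var v))

/-- Fills the table of walks. -/
def fillWalks (d : ℕ) : Code :=
  forLt (plus (times (numeral d) side) (numeral 1)) fun t =>
    forLt order fun u => forLt order fun v =>
      write (walkAddress d (var t) (var u) (var v)) (walkEntry d t u v)

/-- Checks the values of `f` at the points with indices `x`, `y`, whose distance is `r`. -/
def checkPair (d : ℕ) (x y r : Code) : Code :=
  cond (read (plus tableStart x))
    (cond (read (plus tableStart y))
      (read (walkAddress d r (minus (read (plus tableStart x)) (numeral 1))
        (minus (read (plus tableStart y)) (numeral 1))))
      (numeral 1))
    (numeral 1)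

/-- Checks the values of `f` at all pairs of points, where `x`, `y`, `r` account for the
coordinates from the `j`-th on. -/
def checkPairs (d : ℕ) : ℕ → Code → Code → Code → Code
  | 0, x, y, r => checkPair d x y r
  | j + 1, x, y, r =>
    forallLt (plus side (numeral 1)) fun a => forallLt (plus side (numeral 1)) fun b =>
      checkPairs d j (plus (times x (plus side (numeral 1))) (var a))
        (plus (times y (plus side (numeral 1))) (var b))
        (plus r (plus (minus (var a) (var b)) (minus (var b) (var a))))

end Code

open Code

/-- The word in memory begins with `n` and `N`. -/
def IsHeader (M : ℕ → ℕ) (n N : ℕ) : Prop := M 0 = n ∧ M 1 = N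

/-- The address of the entry that tells whether there is a walk of length `t` from `u` to `v`. -/
def walkAddr (d n N t u v : ℕ) : ℕ := 2 + N * N + (n + 1) ^ d + ((t * N + u) * N + v)

section Cost

variable {M : ℕ → ℕ} {Γ : List (ℕ × ℕ)} {n N : ℕ}

theorem runs_side (h : IsHeader M n N) : Runs side M Γ 2 M n :=
  (runs_numeral 0).read.congr_value h.1

theorem runs_order (h : IsHeader M n N) : Runs order M Γ 2 M N :=
  (runs_numeral 1).read.congr_value h.2

theorem exists_runs_tableStart : ∃ T, PolyBounded T ∧ ∀ (M : ℕ → ℕ) (Γ : List (ℕ × ℕ)) (n N : ℕ),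
    IsHeader M n N → Runs tableStart M Γ (T n N) M (2 + N * N) := by
  -- The running time is found by unification with the composed run; its polynomial bound then
  -- follows its shape.
  refine ⟨_, ?_, fun M Γ n N h => (runs_numeral 2).plus ((runs_order h).times (runs_order h))⟩
  repeat' first
    | exact .const _ | exact .fst | exact .snd | apply PolyBounded.mul | apply PolyBounded.add

theorem exists_runs_sidePow (j : ℕ) : ∃ T, PolyBounded T ∧
    ∀ (M : ℕ → ℕ) (Γ : List (ℕ × ℕ)) (n N : ℕ), IsHeader M n N →
      Runs (sidePow j) M Γ (T n N) M ((n + 1) ^ j) := by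
  induction j with
  | zero => exact ⟨_, .const 1, fun M Γ n N _ => runs_numeral 1⟩
  | succ j ih =>
    obtain ⟨T, hT, ih⟩ := ih
    refine ⟨_, ?_, fun M Γ n N h => (ih M Γ n N h).times ((runs_side h).plus (runs_numeral 1))⟩
    repeat' first
      | exact hT | exact .const _ | exact .fst | exact .snd | apply PolyBounded.add
      | apply PolyBounded.mul

theorem exists_runs_walkAddress (d : ℕ) {Tx Ty Tz : ℕ → ℕ → ℕ} (hx : PolyBounded Tx)
    (hy : PolyBounded Ty) (hz : PolyBounded Tz) : ∃ T, PolyBounded T ∧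
    ∀ (M : ℕ → ℕ) (Γ : List (ℕ × ℕ)) (n N : ℕ) (x y z : Code) (a b c : ℕ), IsHeader M n N →
      Runs x M Γ (Tx n N) M a → Runs y M Γ (Ty n N) M b → Runs z M Γ (Tz n N) M c →
      Runs (walkAddress d x y z) M Γ (T n N) M (walkAddr d n N a b c) := by
  obtain ⟨T₁, hT₁, h₁⟩ := exists_runs_tableStart
  obtain ⟨T₂, hT₂, h₂⟩ := exists_runs_sidePow d
  refine ⟨_, ?_, fun M Γ n N x y z a b c h hx hy hz => ((h₁ M Γ n N h).plus (h₂ M Γ n N h)).plus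
    ((((hx.times (runs_order h)).plus hy).times (runs_order h)).plus hz)⟩
  repeat' first
    | exact hT₁ | exact hT₂ | exact hx | exact hy | exact hz | exact .const _ | exact .snd
    | apply PolyBounded.mul | apply PolyBounded.add

open Classical in
theorem exists_runs_walkEntry (d : ℕ) : ∃ T, PolyBounded T ∧
    ∀ (M : ℕ → ℕ) (Γ : List (ℕ × ℕ)) (n N : ℕ) (rt ru rv t u v : ℕ), IsHeader M n N →
      (rt, t) ∈ Γ → (ru, u) ∈ Γ → (rv, v) ∈ Γ → (∀ w < N, M (2 + (w * N + v)) ≤ 1) →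
      Runs (walkEntry d rt ru rv) M Γ (T n N) M
        (if t ≠ 0 then
          if ∃ w < N, M (walkAddr d n N (t - 1) u w) ≠ 0 ∧ M (2 + (w * N + v)) ≠ 0 then 1 else 0
        else if u = v then 1 else 0) := by
  obtain ⟨T₁, hT₁, h₁⟩ := exists_runs_walkAddress d (.const (2 + 1 + 1)) (.const 2) (.const 2)
  refine ⟨_, ?_, fun M Γ n N rt ru rv t u v h ht hu hv hM => (runs_var ht).cond
    (fun _ => (runs_order h).existsLt fun w hw rw Γ' hΓ hrw =>
      ((h₁ M Γ' n N _ _ _ _ _ _ h ((runs_var (hΓ ht)).minus (runs_numeral 1)) (runs_var (hΓ hu))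
        (runs_var hrw)).read.cond
        (fun _ => ((runs_numeral 2).plus (((runs_var hrw).times (runs_order h)).plus
          (runs_var (hΓ hv)))).read)
        fun _ => runs_numeral 0).congr_value ?_)
    fun _ => (runs_var hu).equal (runs_var hv)⟩
  · repeat' first
      | exact hT₁ | exact .const _ | exact .snd | apply PolyBounded.mul | apply PolyBounded.add
  -- The adjacency entry itself is returned as the truth value, so it must be `0` or `1`.
  · have := hM w hw
    split_ifs <;> omega

/-- The values at the points with indices `x`, `y` at distance `r` pass the check. -/
def PairOk (M : ℕ → ℕ) (d n N x y r : ℕ) : Prop :=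
  M (2 + N * N + x) ≠ 0 → M (2 + N * N + y) ≠ 0 →
    M (walkAddr d n N r (M (2 + N * N + x) - 1) (M (2 + N * N + y) - 1)) ≠ 0

/-- All pairs of points with given coordinates from the `j`-th on pass the check. -/
def PairsOk (M : ℕ → ℕ) (d n N : ℕ) : ℕ → ℕ → ℕ → ℕ → Prop
  | 0, x, y, r => PairOk M d n N x y r
  | j + 1, x, y, r => ∀ a < n + 1, ∀ b < n + 1,
    PairsOk M d n N j (x * (n + 1) + a) (y * (n + 1) + b) (r + ((a - b) + (b - a)))

open Classical in
theorem exists_runs_checkPair (d : ℕ) {Tx Ty Tr : ℕ → ℕ → ℕ} (hx : PolyBounded Tx)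
    (hy : PolyBounded Ty) (hr : PolyBounded Tr) : ∃ T, PolyBounded T ∧
    ∀ (M : ℕ → ℕ) (Γ : List (ℕ × ℕ)) (n N : ℕ) (x y r : Code) (a b c : ℕ), IsHeader M n N →
      (∀ k, 2 + N * N + (n + 1) ^ d ≤ k → M k ≤ 1) →
      Runs x M Γ (Tx n N) M a → Runs y M Γ (Ty n N) M b → Runs r M Γ (Tr n N) M c →
      Runs (checkPair d x y r) M Γ (T n N) M (if PairOk M d n N a b c then 1 else 0) := by
  obtain ⟨T₁, hT₁, h₁⟩ := exists_runs_tableStart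
  have hTx : PolyBounded fun n N => T₁ n N + Tx n N + 1 + 1 + 1 + 1 :=
    (((hT₁.add hx).add (.const 1)).add (.const 1)).add (.const 1) |>.add (.const 1)
  have hTy : PolyBounded fun n N => T₁ n N + Ty n N + 1 + 1 + 1 + 1 :=
    (((hT₁.add hy).add (.const 1)).add (.const 1)).add (.const 1) |>.add (.const 1)
  obtain ⟨T₂, hT₂, h₂⟩ := exists_runs_walkAddress d hr hTx hTy
  refine ⟨_, ?_, fun M Γ n N x y r a b c h hM hx hy hr =>
    (((h₁ M Γ n N h).plus hx).read.cond
      (fun _ => ((h₁ M Γ n N h).plus hy).read.cond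
        (fun _ => (h₂ M Γ n N _ _ _ _ _ _ h hr
          (((h₁ M Γ n N h).plus hx).read.minus (runs_numeral 1))
          (((h₁ M Γ n N h).plus hy).read.minus (runs_numeral 1))).read)
        fun _ => runs_numeral 1)
      fun _ => runs_numeral 1).congr_value ?_⟩
  · repeat' first
      | exact hT₁ | exact hT₂ | exact hx | exact hy | exact .const _ | exact .snd
      | apply PolyBounded.mul | apply PolyBounded.add
  · have := hM (walkAddr d n N c (M (2 + N * N + a) - 1) (M (2 + N * N + b) - 1))
      (Nat.le_add_right _ _)
    unfold PairOk
    split_ifs <;> omega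

open Classical in
-- The codes `x`, `y`, `r` are substituted into one another and evaluated anew in the innermost
-- loop. Their costs are therefore arbitrary polynomially bounded functions in the induction; as the
-- depth is fixed, the total stays polynomial.
theorem exists_runs_checkPairs (d j : ℕ) {Tx Ty Tr : ℕ → ℕ → ℕ} (hx : PolyBounded Tx)
    (hy : PolyBounded Ty) (hr : PolyBounded Tr) : ∃ T, PolyBounded T ∧
    ∀ (M : ℕ → ℕ) (Γ : List (ℕ × ℕ)) (n N : ℕ) (x y r : Code) (a b c : ℕ), IsHeader M n N →
      (∀ k, 2 + N * N + (n + 1) ^ d ≤ k → M k ≤ 1) →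
      Runs x M Γ (Tx n N) M a → Runs y M Γ (Ty n N) M b → Runs r M Γ (Tr n N) M c →
      Runs (checkPairs d j x y r) M Γ (T n N) M (if PairsOk M d n N j a b c then 1 else 0) := by
  induction j generalizing Tx Ty Tr with
  | zero => exact exists_runs_checkPair d hx hy hr
  | succ j ih =>
    have digit : ∀ {S : ℕ → ℕ → ℕ}, PolyBounded S →
        PolyBounded fun n N => 2 + 1 + 1 + 1 + (n + 1) * (2 + S n N + 1 + 6) + 4 + 2 + 1 := by
      intro S hS
      repeat' first
        | exact hS | exact .const _ | exact .fst | apply PolyBounded.mul | apply PolyBounded.add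
    have hTr : PolyBounded fun n N => Tr n N + (2 + 2 + 1 + (2 + 2 + 1) + 1) + 1 :=
      (hr.add (.const _)).add (.const 1)
    obtain ⟨T, hT, h⟩ := ih (digit hx) (digit hy) hTr
    refine ⟨_, ?_, fun M Γ n N x y r a b c hh hM hx hy hr =>
      (((runs_side hh).plus (runs_numeral 1)).forallLt (P := fun i => ∀ l < n + 1,
          PairsOk M d n N j (a * (n + 1) + i) (b * (n + 1) + l) (c + ((i - l) + (l - i))))
        fun i hi r₁ Γ₁ hΓ₁ hr₁ =>
        ((runs_side hh).plus (runs_numeral 1)).forallLt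
          fun l hl r₂ Γ₂ hΓ₂ hr₂ => h M Γ₂ n N _ _ _ _ _ _ hh hM
            (((hx.mono_context (List.Subset.trans hΓ₁ hΓ₂)).times ((runs_side hh).plus (runs_numeral 1))).plus
              (runs_var (hΓ₂ hr₁)))
            (((hy.mono_context (List.Subset.trans hΓ₁ hΓ₂)).times ((runs_side hh).plus (runs_numeral 1))).plus
              (runs_var hr₂))
            ((hr.mono_context (List.Subset.trans hΓ₁ hΓ₂)).plus
              (((runs_var (hΓ₂ hr₁)).minus (runs_var hr₂)).plus
                ((runs_var hr₂).minus (runs_var (hΓ₂ hr₁)))))).congr_value ?_⟩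
    · repeat' first
        | exact hT | exact .const _ | exact .fst | apply PolyBounded.mul | apply PolyBounded.add
    · simp only [PairsOk]
      congr

/-- Horner's rule: the outermost loop supplies the most significant digit, which is the last
coordinate, hence `Fin.snoc`. -/
theorem pairsOk_iff {d : ℕ} (j x y r : ℕ) : PairsOk M d n N j x y r ↔
    ∀ a b : Fin j → Fin (n + 1), PairOk M d n N (x * (n + 1) ^ j + finFunctionFinEquiv a)
      (y * (n + 1) ^ j + finFunctionFinEquiv b)
      (r + ∑ i, (((a i : ℕ) - b i) + ((b i : ℕ) - a i))) := by
  induction j generalizing x y r with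
  | zero => simp [PairsOk]
  | succ j ih =>
    have key : ∀ (a b : Fin j → Fin (n + 1)) (p q : Fin (n + 1)),
        PairOk M d n N ((x * (n + 1) + p) * (n + 1) ^ j + finFunctionFinEquiv a)
          ((y * (n + 1) + q) * (n + 1) ^ j + finFunctionFinEquiv b)
          (r + (((p : ℕ) - q) + ((q : ℕ) - p)) + ∑ i, (((a i : ℕ) - b i) + ((b i : ℕ) - a i))) ↔
        PairOk M d n N
          (x * (n + 1) ^ (j + 1) + finFunctionFinEquiv (Fin.snoc a p : Fin (j + 1) → Fin (n + 1)))
          (y * (n + 1) ^ (j + 1) + finFunctionFinEquiv (Fin.snoc b q : Fin (j + 1) → Fin (n + 1)))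
          (r + ∑ i, ((((Fin.snoc a p : Fin (j + 1) → Fin (n + 1)) i : ℕ) -
            (Fin.snoc b q : Fin (j + 1) → Fin (n + 1)) i) +
            (((Fin.snoc b q : Fin (j + 1) → Fin (n + 1)) i : ℕ) -
            (Fin.snoc a p : Fin (j + 1) → Fin (n + 1)) i))) := by
      intro a b p q
      simp only [finFunctionFinEquiv_apply, Fin.sum_univ_castSucc, Fin.snoc_castSucc,
        Fin.snoc_last, Fin.val_castSucc, Fin.val_last]
      rw [iff_iff_eq]
      congr 1 <;> ring
    simp only [PairsOk, ih]
    constructor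
    · intro h a b
      rw [← Fin.snoc_init_self a, ← Fin.snoc_init_self b, ← key]
      exact h _ (a (Fin.last j)).2 _ (b (Fin.last j)).2 _ _
    · intro h p hp q hq a b
      exact (key a b ⟨p, hp⟩ ⟨q, hq⟩).2 (h _ _)

end Cost

/-! ### Correctness of the table of walks. -/

section Fill

variable {N : ℕ} (H : SimpleGraph (Fin N))

open Classical in
/-- Tells whether there is a walk of length `t` from `u` to `v`. -/
noncomputable def walkBit (t u v : ℕ) : ℕ :=
  if ∃ (hu : u < N) (hv : v < N), H.HasWalk ⟨u, hu⟩ ⟨v, hv⟩ t then 1 else 0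

/-- The memory `M`, with the first `q` entries of the table of walks added to it. -/
noncomputable def walkMem (d n : ℕ) (M : ℕ → ℕ) (q a : ℕ) : ℕ :=
  if a < 2 + N * N + (n + 1) ^ d ∨ 2 + N * N + (n + 1) ^ d + q ≤ a then M a
  else walkBit H ((a - (2 + N * N + (n + 1) ^ d)) / N / N)
    ((a - (2 + N * N + (n + 1) ^ d)) / N % N) ((a - (2 + N * N + (n + 1) ^ d)) % N)

variable {H} {d n t u v q a : ℕ} {M : ℕ → ℕ}

theorem walkMem_zero : walkMem H d n M 0 = M := by
  funext a
  exact if_pos (by omega)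

theorem walkMem_of_lt (h : a < 2 + N * N + (n + 1) ^ d) : walkMem H d n M q a = M a :=
  if_pos (Or.inl h)

theorem walkMem_eq_walkBit (hu : u < N) (hv : v < N) (hq : (t * N + u) * N + v < q) :
    walkMem H d n M q (walkAddr d n N t u v) = walkBit H t u v := by
  have hN : 0 < N := by omega
  rw [walkMem, if_neg (by unfold walkAddr; omega), walkAddr, Nat.add_sub_cancel_left]
  have h₁ : ((t * N + u) * N + v) / N = t * N + u := by
    rw [mul_comm, Nat.mul_add_div hN, Nat.div_eq_of_lt hv, add_zero]
  have h₂ : (t * N + u) / N = t := by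
    rw [mul_comm, Nat.mul_add_div hN, Nat.div_eq_of_lt hu, add_zero]
  rw [h₁, h₂, mul_comm t, mul_comm _ N, Nat.mul_add_mod, Nat.mul_add_mod, Nat.mod_eq_of_lt hu,
    Nat.mod_eq_of_lt hv]

/-- The table is filled in the order of addresses, so a single number records the progress. -/
theorem walkMem_succ (hu : u < N) (hv : v < N) :
    Function.update (walkMem H d n M ((t * N + u) * N + v)) (walkAddr d n N t u v)
      (walkBit H t u v) = walkMem H d n M ((t * N + u) * N + v + 1) := by
  funext a
  obtain rfl | ha := eq_or_ne a (walkAddr d n N t u v)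
  · rw [Function.update_self, walkMem_eq_walkBit hu hv (Nat.lt_succ_self _)]
  · rw [Function.update_of_ne ha]
    unfold walkMem
    unfold walkAddr at ha
    congr 1
    rw [eq_iff_iff]
    omega

theorem walkMem_le_one (hM : ∀ k, 2 + N * N + (n + 1) ^ d ≤ k → M k ≤ 1)
    (ha : 2 + N * N + (n + 1) ^ d ≤ a) : walkMem H d n M q a ≤ 1 := by
  unfold walkMem walkBit
  split_ifs
  · exact hM a ha
  · exact le_rfl
  · exact zero_le_one

theorem IsHeader.walkMem (h : IsHeader M n N) : IsHeader (walkMem H d n M q) n N :=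
  ⟨by rw [walkMem_of_lt (by omega), h.1], by rw [walkMem_of_lt (by omega), h.2]⟩

theorem mul_add_lt_mul_self {w v N : ℕ} (hw : w < N) (hv : v < N) : w * N + v < N * N := by
  have := Nat.mul_le_mul_right N (Nat.succ_le_of_lt hw)
  rw [Nat.succ_mul] at this
  omega

open Classical in
-- Split off the last edge of the walk: the entries for length `t - 1` come earlier in the table and
-- are already final.
theorem walkEntry_eq_walkBit
    (hM : ∀ u v : Fin N, M (2 + (u * N + v)) = if H.Adj u v then 1 else 0)
    (hu : u < N) (hv : v < N) :
    (if t ≠ 0 then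
      if ∃ w < N, walkMem H d n M ((t * N + u) * N + v) (walkAddr d n N (t - 1) u w) ≠ 0 ∧
        walkMem H d n M ((t * N + u) * N + v) (2 + (w * N + v)) ≠ 0 then 1 else 0
    else if u = v then 1 else 0) = walkBit H t u v := by
  cases t with
  | zero => simp [walkBit, hu, hv, SimpleGraph.hasWalk_zero]
  | succ t =>
    have h₁ : ∀ w, w < N → walkMem H d n M (((t + 1) * N + u) * N + v) (walkAddr d n N t u w) =
        walkBit H t u w := fun w hw => walkMem_eq_walkBit hu hw (by
      have h₁ : ((t + 1) * N + u) * N = (t * N + u) * N + N * N := by ring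
      have h₂ := Nat.le_mul_self N
      omega)
    have h₂ : ∀ (w : ℕ) (hw : w < N), walkMem H d n M (((t + 1) * N + u) * N + v)
        (2 + (w * N + v)) = if H.Adj ⟨w, hw⟩ ⟨v, hv⟩ then 1 else 0 := fun w hw => by
      have := mul_add_lt_mul_self hw hv
      rw [walkMem_of_lt (by omega), ← hM ⟨w, hw⟩ ⟨v, hv⟩]
    rw [if_pos (Nat.succ_ne_zero t), Nat.add_sub_cancel, walkBit]
    congr 1
    rw [eq_iff_iff]
    constructor
    · rintro ⟨w, hw, hw₁, hw₂⟩
      rw [h₁ w hw, walkBit, ne_eq, ite_eq_right_iff, not_forall] at hw₁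
      rw [h₂ w hw, ne_eq, ite_eq_right_iff, not_forall] at hw₂
      obtain ⟨⟨_, _, hw₁⟩, -⟩ := hw₁
      obtain ⟨hw₂, -⟩ := hw₂
      exact ⟨hu, hv, SimpleGraph.hasWalk_succ.2 ⟨_, hw₁, hw₂⟩⟩
    · rintro ⟨_, _, h⟩
      obtain ⟨w, hw₁, hw₂⟩ := SimpleGraph.hasWalk_succ.1 h
      refine ⟨w, w.2, ?_, ?_⟩
      · rw [h₁ w w.2, walkBit, if_pos ⟨hu, w.2, hw₁⟩]
        exact one_ne_zero
      · rw [h₂ w w.2, if_pos hw₂]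
        exact one_ne_zero

open Classical in
theorem exists_runs_fillWalks (d : ℕ) : ∃ T, PolyBounded T ∧
    ∀ (M : ℕ → ℕ) (n N : ℕ) (H : SimpleGraph (Fin N)), IsHeader M n N →
      (∀ u v : Fin N, M (2 + (u * N + v)) = if H.Adj u v then 1 else 0) →
      Runs (fillWalks d) M [] (T n N) (walkMem H d n M (((d * n + 1) * N) * N)) 0 := by
  obtain ⟨T₁, hT₁, h₁⟩ := exists_runs_walkAddress d (.const 2) (.const 2) (.const 2)
  obtain ⟨T₂, hT₂, h₂⟩ := exists_runs_walkEntry d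
  refine ⟨fun n N => (2 + 1 + n * (2 + 1 + 1 + 6) + 4 + 1 + 1) + 1 + (d * n + 1) *
    ((2 + 1 + N * ((2 + 1 + N * ((T₁ n N + T₂ n N + 1) + 1 + 6) + 4) + 1 + 6) + 4) + 1 + 6) + 4,
    ?hT, fun M n N H h hM => ?h⟩
  case h =>
    refine Runs.forLt (m := fun t => walkMem H d n M ((t * N) * N)) (Γ := [])
      (b := d * n + 1) ?_ fun t ht rt Γ₁ _ hrt => ⟨0, ?_⟩
    · rw [zero_mul, zero_mul, walkMem_zero]
      exact ((runs_numeral d).times (runs_side h)).plus (runs_numeral 1)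
    -- Where the inner loop ends, the next round of the outer one begins: `(t + 1) * N = t * N + N`.
    · rw [Nat.succ_mul t N]
      refine Runs.forLt (m := fun u => walkMem H d n M ((t * N + u) * N))
        (runs_order h.walkMem) fun u hu ru Γ₂ hΓ₂ hru => ⟨0, ?_⟩
      rw [← add_assoc, Nat.succ_mul (t * N + u) N]
      refine Runs.forLt (m := fun v => walkMem H d n M ((t * N + u) * N + v))
        (runs_order h.walkMem) fun v hv rv Γ₃ hΓ₃ hrv => ⟨walkAddr d n N t u v, ?_⟩
      have hrt' := hΓ₃ (hΓ₂ hrt)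
      have hru' := hΓ₃ hru
      have hr := (h₁ (walkMem H d n M ((t * N + u) * N + v)) Γ₃ n N _ _ _ _ _ _ h.walkMem
        (runs_var hrt') (runs_var hru') (runs_var hrv)).write
        (h₂ _ Γ₃ n N rt ru rv t u v h.walkMem hrt' hru' hrv fun w hw => by
          have := mul_add_lt_mul_self hw hv
          rw [walkMem_of_lt (by omega), hM ⟨w, hw⟩ ⟨v, hv⟩]
          split_ifs <;> simp)
      rw [walkEntry_eq_walkBit hM hu hv, walkMem_succ hu hv] at hr
      exact hr
  case hT =>
    repeat' first
      | exact hT₁ | exact hT₂ | exact .const _ | exact .fst | exact .snd | apply PolyBounded.add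
      | apply PolyBounded.mul

end Fill

end RAM

/-! ### Reading the input word. -/

section Instance

open RAM

variable {N d n : ℕ} {H : SimpleGraph (Fin N)} (f : boundaryGraph d n →g H)

theorem length_adjacencyWord : (adjacencyWord H).length = N * N := List.length_ofFn

theorem length_boundaryWord : (boundaryWord f).length = (n + 1) ^ d := List.length_ofFn

theorem isHeader_instanceWord : IsHeader (initialState (instanceWord f)).mem n N := ⟨rfl, rfl⟩

theorem initialState_mem_add_two (a : ℕ) : (initialState (instanceWord f)).mem (2 + a) =
    (adjacencyWord H ++ boundaryWord f).getD a 0 := by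
  rw [add_comm]
  rfl

open Classical in
theorem initialState_mem_adj (u v : Fin N) :
    (initialState (instanceWord f)).mem (2 + (u * N + v)) = if H.Adj u v then 1 else 0 := by
  have h := mul_add_lt_mul_self u.2 v.2
  have hN : 0 < N := u.pos
  rw [initialState_mem_add_two, List.getD_append _ _ _ _ (by rwa [length_adjacencyWord]),
    List.getD_eq_getElem _ _ (by rwa [length_adjacencyWord])]
  unfold adjacencyWord
  rw [List.getElem_ofFn]
  have h₁ : (⟨u * N + v, h⟩ : Fin (N * N)).divNat = u := by
    ext
    rw [Fin.coe_divNat]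
    dsimp only
    rw [mul_comm, Nat.mul_add_div hN, Nat.div_eq_of_lt v.2, add_zero]
  have h₂ : (⟨u * N + v, h⟩ : Fin (N * N)).modNat = v := by
    ext
    rw [Fin.coe_modNat]
    dsimp only
    rw [mul_comm, Nat.mul_add_mod, Nat.mod_eq_of_lt v.2]
  rw [h₁, h₂]

open Classical in
theorem initialState_mem_table (k : Fin ((n + 1) ^ d)) :
    (initialState (instanceWord f)).mem (2 + N * N + k) =
      if h : boxPoint k ∈ boxBoundary d n then (f ⟨boxPoint k, h⟩ : ℕ) + 1 else 0 := by
  rw [add_assoc, initialState_mem_add_two, List.getD_append_right _ _ _ _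
    (by rw [length_adjacencyWord]; omega), length_adjacencyWord, Nat.add_sub_cancel_left,
    List.getD_eq_getElem _ _ (by rw [length_boundaryWord]; exact k.2)]
  unfold boundaryWord
  rw [List.getElem_ofFn]

theorem initialState_mem_of_le {a : ℕ} (ha : 2 + N * N + (n + 1) ^ d ≤ a) :
    (initialState (instanceWord f)).mem a = 0 := by
  obtain ⟨b, rfl⟩ := Nat.exists_eq_add_of_le (show 2 ≤ a by omega)
  rw [initialState_mem_add_two, List.getD_eq_default]
  rw [List.length_append, length_adjacencyWord, length_boundaryWord]
  omega

theorem boxPoint_finFunctionFinEquiv (a : Fin d → Fin (n + 1)) :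
    boxPoint (finFunctionFinEquiv a) = fun i => ((a i : ℕ) : ℤ) := by
  funext i
  rw [boxPoint, Equiv.symm_apply_apply]

theorem exists_boxPoint_eq {x : Fin d → ℤ} (hx : x ∈ box d n) :
    ∃ a : Fin d → Fin (n + 1), (fun i => ((a i : ℕ) : ℤ)) = x := by
  refine ⟨fun i => ⟨(x i).toNat, ?_⟩, funext fun i => ?_⟩
  · have := hx i
    omega
  · exact Int.toNat_of_nonneg (hx i).1

theorem sum_dist_eq_l1Dist (a b : Fin d → Fin (n + 1)) :
    ∑ i, (((a i : ℕ) - b i) + ((b i : ℕ) - a i)) =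
      l1Dist (fun i => ((a i : ℕ) : ℤ)) (fun i => ((b i : ℕ) : ℤ)) :=
  Finset.sum_congr rfl fun i _ => by dsimp only; omega

theorem l1Dist_le_of_mem_box {x y : Fin d → ℤ} (hx : x ∈ box d n) (hy : y ∈ box d n) :
    l1Dist x y ≤ d * n := by
  refine (Finset.sum_le_card_nsmul Finset.univ _ n fun i _ => ?_).trans (by simp)
  have := hx i
  have := hy i
  omega

/-- Distances in the box are at most `d * n`, so every entry looked up lies in the filled table.
Points of the hole have table value `0` and are skipped; subtracting `1` from the other values
recovers `f`. -/
theorem pairsOk_iff_boundaryWalks :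
    PairsOk (walkMem H d n (initialState (instanceWord f)).mem (((d * n + 1) * N) * N)) d n N d 0 0 0
      ↔ BoundaryWalks f := by
  classical
  rw [pairsOk_iff]
  simp only [zero_mul, zero_add, PairOk]
  have hmem : ∀ k : Fin ((n + 1) ^ d), walkMem H d n (initialState (instanceWord f)).mem
      (((d * n + 1) * N) * N) (2 + N * N + k) =
      if h : boxPoint k ∈ boxBoundary d n then (f ⟨boxPoint k, h⟩ : ℕ) + 1 else 0 := fun k => by
    rw [walkMem_of_lt (by omega), initialState_mem_table]
  have key : ∀ (a b : Fin d → Fin (n + 1)) (ha : (fun i => ((a i : ℕ) : ℤ)) ∈ boxBoundary d n)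
      (hb : (fun i => ((b i : ℕ) : ℤ)) ∈ boxBoundary d n),
      walkMem H d n (initialState (instanceWord f)).mem (((d * n + 1) * N) * N)
        (walkAddr d n N (l1Dist (fun i => ((a i : ℕ) : ℤ)) (fun i => ((b i : ℕ) : ℤ)))
          (f ⟨_, ha⟩) (f ⟨_, hb⟩)) ≠ 0 ↔ H.HasWalk (f ⟨_, ha⟩) (f ⟨_, hb⟩)
        (l1Dist (fun i => ((a i : ℕ) : ℤ)) (fun i => ((b i : ℕ) : ℤ))) := by
    intro a b ha hb
    rw [walkMem_eq_walkBit (f ⟨_, ha⟩).2 (f ⟨_, hb⟩).2]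
    · simp [walkBit]
    · have h₁ := l1Dist_le_of_mem_box ha.1 hb.1
      generalize l1Dist (fun i => ((a i : ℕ) : ℤ)) (fun i => ((b i : ℕ) : ℤ)) = r at h₁
      have h₂ := mul_add_lt_mul_self (f ⟨_, ha⟩).2 (f ⟨_, hb⟩).2
      have h₃ := Nat.mul_le_mul_right N (Nat.mul_le_mul_right N (Nat.succ_le_succ h₁))
      simp only [Nat.succ_eq_add_one, add_mul, one_mul] at h₃ ⊢
      omega
  constructor
  · rintro h ⟨x, hx⟩ ⟨y, hy⟩
    obtain ⟨a, rfl⟩ := exists_boxPoint_eq hx.1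
    obtain ⟨b, rfl⟩ := exists_boxPoint_eq hy.1
    have := h a b
    simp only [hmem, boxPoint_finFunctionFinEquiv, sum_dist_eq_l1Dist, dif_pos hx, dif_pos hy,
      Nat.add_sub_cancel] at this
    exact (key a b hx hy).1 (this (Nat.succ_ne_zero _) (Nat.succ_ne_zero _))
  · intro h a b ha hb
    have hx : (fun i => ((a i : ℕ) : ℤ)) ∈ boxBoundary d n := by
      by_contra hx
      rw [hmem, boxPoint_finFunctionFinEquiv, dif_neg hx] at ha
      exact ha rfl
    have hy : (fun i => ((b i : ℕ) : ℤ)) ∈ boxBoundary d n := by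
      by_contra hy
      rw [hmem, boxPoint_finFunctionFinEquiv, dif_neg hy] at hb
      exact hb rfl
    simp only [hmem, boxPoint_finFunctionFinEquiv, sum_dist_eq_l1Dist, dif_pos hx, dif_pos hy,
      Nat.add_sub_cancel]
    exact (key a b hx hy).2 (h ⟨_, hx⟩ ⟨_, hy⟩)

end Instance

/-- There is a program that decides in polynomial time whether any two boundary values are joined
by a walk whose length is the distance of the points. -/
theorem exists_program_boundaryWalks (d : ℕ) : ∃ (P : RAM.Program) (p : Polynomial ℕ),
    ∀ (N : ℕ) (H : SimpleGraph (Fin N)) (n : ℕ) (f : boundaryGraph d n →g H),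
      RAM.AnswersWithin P (instanceWord f) (BoundaryWalks f) (p.eval (n + N)) := by
  classical
  obtain ⟨T₁, hT₁, h₁⟩ := RAM.exists_runs_fillWalks d
  obtain ⟨T₂, hT₂, h₂⟩ := RAM.exists_runs_checkPairs d d (.const 1) (.const 1) (.const 1)
  obtain ⟨p, hp⟩ := hT₁.add hT₂
  refine ⟨RAM.Code.andThen (RAM.Code.fillWalks d) (RAM.Code.checkPairs d d (RAM.Code.numeral 0)
    (RAM.Code.numeral 0) (RAM.Code.numeral 0)) 0, p, fun N H n f => ?_⟩
  have hhead := isHeader_instanceWord f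
  obtain ⟨t, ht, s, hex, -, -, hs⟩ := ((h₁ _ n N H hhead (initialState_mem_adj f)).andThen
    (h₂ _ [] n N _ _ _ _ _ _ hhead.walkMem
      (fun k hk => RAM.walkMem_le_one
        (fun k hk => (initialState_mem_of_le f hk).trans_le zero_le_one) hk)
      (RAM.runs_numeral 0) (RAM.runs_numeral 0) (RAM.runs_numeral 0)))
    0 (RAM.initialState (instanceWord f)) rfl (by simp)
  rw [pairsOk_iff_boundaryWalks] at hs
  exact ⟨t, s, ht.trans (hp n N), hex, fun h => by rw [hs, if_pos h],
    fun h => by rw [hs, if_neg h]⟩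

theorem mainTheorem5 (d : ℕ) (hd : 1 ≤ d) :
    (∃ (P : RAM.Program) (p : Polynomial ℕ),
      ∀ (N : ℕ) (H : SimpleGraph (Fin N)), H.Connected → IsBipartiteHelly H (2 * d) 2 →
        ∀ (n : ℕ) (f : boundaryGraph d n →g H),
          RAM.AnswersWithin P (instanceWord f) (ExtendsToBox f) (p.eval (n + N))) ∧
    (∀ (V : Type*) [Finite V] (H : SimpleGraph V), H.Connected → IsBipartiteHelly H (2 * d) 2 →
      ∀ (n : ℕ) (f : boundaryGraph d n →g H),
        (2 ≤ d → (ExtendsToBox f ↔ IsOneLipschitz f)) ∧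
        (d = 1 → Nontrivial V → (ExtendsToBox f ↔
          IsOneLipschitz f ∧ ∀ x y : boxBoundary d n,
            Even (H.dist (f x) (f y) + (latticeGraph d).dist x.1 y.1)))) := by
  refine ⟨?_, fun V _ H hH hHelly n f => ⟨fun h => extendsToBox_iff_isOneLipschitz h hH hHelly,
    fun _ _ => ?_⟩⟩
  · obtain ⟨P, p, h⟩ := exists_program_boundaryWalks d
    refine ⟨P, p, fun N H hH hHelly n f => ?_⟩
    rw [extendsToBox_iff_boundaryWalks hd hH hHelly]
    exact h N H n f
  · rw [extendsToBox_iff_boundaryWalks hd hH hHelly,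
      boundaryWalks_iff_isOneLipschitz_and hH hHelly.1]
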